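/- Let $\kappa : G \to GL(n,\mathbb{R})$ be an irreducible self-dual representation of a group $G$ on $\mathbb{R}^n$ (self-dual: isomorphic to its dual representation). Let $End_G$ be the algebra of endomorphisms of $\mathbb{R}^n$ commuting with $\kappa(G)$, and $S_G$, $\Lambda_G$ the spaces of $\kappa(G)$-invariant symmetric, respectively skew-symmetric, bilinear forms on $\mathbb{R}^n$. Then one of the following holds: 1. $End_G \cong \mathbb{R}$, $(\dim S_G,\dim\Lambda_G)=(1,0)$, and up to conjugation $\kappa(G)\subset O(p,q)$ for some $p+q=n$; 2. $End_G \cong \mathbb{R}$, $(\dim S_G,\dim\Lambda_G)=(0,1)$, $n$ is even and up to conjugation $\kappa(G)\subset Sp(n/2,\mathbb{R})$; 3. $End_G \cong \mathbb{C}$, $(\dim S_G,\dim\Lambda_G)=(2,0)$, $n$ is even, $n\ge 4$ and up to conjugation $\kappa(G)\subset O(n/2,\mathbb{C})$; 4. $End_G \cong \mathbb{C}$, $(\dim S_G,\dim\Lambda_G)=(0,2)$, $4\mid n$ and up to conjugation $\kappa(G)\subset Sp(n/4,\mathbb{C})$; 5. $End_G \cong \mathbb{C}$, $(\dim S_G,\dim\Lambda_G)=(1,1)$,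 and up to conjugation $\kappa(G)\subset U(p/2,q/2)$ for some even $p,q$ with $p+q=n$; 6. $End_G \cong \mathbb{H}$, $(\dim S_G,\dim\Lambda_G)=(1,3)$, and up to conjugation $\kappa(G)\subset Sp(p/4,q/4)$ for some $p,q$ divisible by $4$ with $p+q=n$; 7. $End_G \cong \mathbb{H}$, $(\dim S_G,\dim\Lambda_G)=(3,1)$, $4\mid n$, $n\ge 8$ and up to conjugation $\kappa(G)\subset O^*(n/4)$. Here, with $I_{p,q}=\mathrm{diag}(-1_p,1_q)$ and $J_m=\begin{pmatrix}0&-1_m\\1_m&0\end{pmatrix}$: $O(p,q)=\{A\in GL(p+q,\mathbb{R}) : A^tI_{p,q}A=I_{p,q}\}$; $Sp(m,\mathbb{K})=\{A\in GL(2m,\mathbb{K}) : A^tJ_mA=J_m\}$ for $\mathbb{K}=\mathbb{R},\mathbb{C}$; $O(m,\mathbb{C})=\{A\in GL(m,\mathbb{C}) : A^tA=1\}$; $U(r,s)$ and $Sp(r,s)$ consist of the $A$ in $GL(r+s,\mathbb{C})$, respectively $GL(r+s,\mathbb{H})$, with $\overline{A}^tI_{r,s}A=I_{r,s}$; and $O^*(m)=\{A\in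 GL(m,\mathbb{H}) : \overline{A}^t\,i1_m\,A=i1_m\}$. The groups are embedded through the injective homomorphisms $GL(m,\mathbb{C})\to GL(2m,\mathbb{R})$, $A+iB\mapsto\begin{pmatrix}A&-B\\B&A\end{pmatrix}$, and $GL(m,\mathbb{H})\to GL(2m,\mathbb{C})$, $U+Vj\mapsto\begin{pmatrix}U&-V\\\overline{V}&\overline{U}\end{pmatrix}$. Moreover, for all $m,r,s\ge 0$, with these embeddings (the first three identities in $GL(2m,\mathbb{R})$, $GL(4m,\mathbb{R})$, $GL(2(r+s),\mathbb{R})$, the last two in $GL(2(r+s),\mathbb{C})$, $GL(2m,\mathbb{C})$): - $O(m,\mathbb{C}) = O(m,m)\cap GL(m,\mathbb{C})$; - $Sp(m,\mathbb{C}) = H\cap GL(2m,\mathbb{C})$, where $H$ is the isometry group of the bilinear form $\mathrm{diag}(J_m,-J_m)$ and is conjugate to $Sp(2m,\mathbb{R})$; - $U(r,s)=H\cap H'$, where $H$, $H'$ are the isometry groups of the bilinear forms $\mathrm{diag}(I_{r,s},I_{r,s})$ and $\begin{pmatrix}0&I_{r,s}\\-I_{r,s}&0\end{pmatrix}$ and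 are conjugate to $O(2r,2s)$ and $Sp(r+s,\mathbb{R})$; - $Sp(r,s)=H\cap H'$, where $H$ is the isometry group of the Hermitian form $\mathrm{diag}(I_{r,s},I_{r,s})$, conjugate to $U(2r,2s)$, and $H'$ is the isometry group of the bilinear form $\begin{pmatrix}0&-I_{r,s}\\I_{r,s}&0\end{pmatrix}$, conjugate to $Sp(r+s,\mathbb{C})$; - $O^*(m)=U(m,m)\cap H'$, where $H'$ is the isometry group of the bilinear form $\begin{pmatrix}0&1_m\\1_m&0\end{pmatrix}$, conjugate to $O(2m,\mathbb{C})$. -/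

import Mathlib

open Matrix

namespace ClassicalGroups

section Groups

variable {ι ι' K : Type*} [Fintype ι] [DecidableEq ι] [Fintype ι'] [DecidableEq ι']

/-- The isometry group `{A | Aᵀ Φ A = Φ}` of the bilinear form with Gram matrix `Φ`. -/
def bilinIsom [CommRing K] (Φ : Matrix ι ι K) : Subgroup (GL ι K) where
  carrier := {A | (A : Matrix ι ι K)ᵀ * Φ * (A : Matrix ι ι K) = Φ}
  one_mem' := by simp
  mul_mem' := by
    intro A B hA hB
    have hA' : (A : Matrix ι ι K)ᵀ * Φ * (A : Matrix ι ι K) = Φ := hA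
    have hB' : (B : Matrix ι ι K)ᵀ * Φ * (B : Matrix ι ι K) = Φ := hB
    change ((A * B : GL ι K) : Matrix ι ι K)ᵀ * Φ * ((A * B : GL ι K) : Matrix ι ι K) = Φ
    calc ((A * B : GL ι K) : Matrix ι ι K)ᵀ * Φ * ((A * B : GL ι K) : Matrix ι ι K)
        = (B : Matrix ι ι K)ᵀ * ((A : Matrix ι ι K)ᵀ * Φ * (A : Matrix ι ι K)) *
            (B : Matrix ι ι K) := by
          simp only [Units.val_mul, Matrix.transpose_mul, Matrix.mul_assoc]
      _ = Φ := by rw [hA', hB']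
  inv_mem' := by
    intro A hA
    have hA' : (A : Matrix ι ι K)ᵀ * Φ * (A : Matrix ι ι K) = Φ := hA
    have h1 : (A : Matrix ι ι K) * ((A⁻¹ : GL ι K) : Matrix ι ι K) = 1 := A.mul_inv
    have h2 : ((A⁻¹ : GL ι K) : Matrix ι ι K)ᵀ * (A : Matrix ι ι K)ᵀ = 1 := by
      rw [← Matrix.transpose_mul, h1, Matrix.transpose_one]
    change ((A⁻¹ : GL ι K) : Matrix ι ι K)ᵀ * Φ * ((A⁻¹ : GL ι K) : Matrix ι ι K) = Φ
    calc ((A⁻¹ : GL ι K) : Matrix ι ι K)ᵀ * Φ * ((A⁻¹ : GL ι K) : Matrix ι ι K)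
        = ((A⁻¹ : GL ι K) : Matrix ι ι K)ᵀ *
            ((A : Matrix ι ι K)ᵀ * Φ * (A : Matrix ι ι K)) *
            ((A⁻¹ : GL ι K) : Matrix ι ι K) := by rw [hA']
      _ = (((A⁻¹ : GL ι K) : Matrix ι ι K)ᵀ * (A : Matrix ι ι K)ᵀ) * Φ *
            ((A : Matrix ι ι K) * ((A⁻¹ : GL ι K) : Matrix ι ι K)) := by
          simp only [Matrix.mul_assoc]
      _ = Φ := by rw [h1, h2, Matrix.one_mul, Matrix.mul_one]

/-- The isometry group `{A | Aᴴ Φ A = Φ}` of the sesquilinear form with Gram matrix `Φ`,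
over a possibly noncommutative ring with involution. -/
def sesqIsom [Ring K] [StarRing K] (Φ : Matrix ι ι K) : Subgroup (GL ι K) where
  carrier := {A | (A : Matrix ι ι K)ᴴ * Φ * (A : Matrix ι ι K) = Φ}
  one_mem' := by simp
  mul_mem' := by
    intro A B hA hB
    have hA' : (A : Matrix ι ι K)ᴴ * Φ * (A : Matrix ι ι K) = Φ := hA
    have hB' : (B : Matrix ι ι K)ᴴ * Φ * (B : Matrix ι ι K) = Φ := hB
    change ((A * B : GL ι K) : Matrix ι ι K)ᴴ * Φ * ((A * B : GL ι K) : Matrix ι ι K) = Φ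
    calc ((A * B : GL ι K) : Matrix ι ι K)ᴴ * Φ * ((A * B : GL ι K) : Matrix ι ι K)
        = (B : Matrix ι ι K)ᴴ * ((A : Matrix ι ι K)ᴴ * Φ * (A : Matrix ι ι K)) *
            (B : Matrix ι ι K) := by
          simp only [Units.val_mul, Matrix.conjTranspose_mul, Matrix.mul_assoc]
      _ = Φ := by rw [hA', hB']
  inv_mem' := by
    intro A hA
    have hA' : (A : Matrix ι ι K)ᴴ * Φ * (A : Matrix ι ι K) = Φ := hA
    have h1 : (A : Matrix ι ι K) * ((A⁻¹ : GL ι K) : Matrix ι ι K) = 1 := A.mul_inv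
    have h2 : ((A⁻¹ : GL ι K) : Matrix ι ι K)ᴴ * (A : Matrix ι ι K)ᴴ = 1 := by
      rw [← Matrix.conjTranspose_mul, h1, Matrix.conjTranspose_one]
    change ((A⁻¹ : GL ι K) : Matrix ι ι K)ᴴ * Φ * ((A⁻¹ : GL ι K) : Matrix ι ι K) = Φ
    calc ((A⁻¹ : GL ι K) : Matrix ι ι K)ᴴ * Φ * ((A⁻¹ : GL ι K) : Matrix ι ι K)
        = ((A⁻¹ : GL ι K) : Matrix ι ι K)ᴴ *
            ((A : Matrix ι ι K)ᴴ * Φ * (A : Matrix ι ι K)) *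
            ((A⁻¹ : GL ι K) : Matrix ι ι K) := by rw [hA']
      _ = (((A⁻¹ : GL ι K) : Matrix ι ι K)ᴴ * (A : Matrix ι ι K)ᴴ) * Φ *
            ((A : Matrix ι ι K) * ((A⁻¹ : GL ι K) : Matrix ι ι K)) := by
          simp only [Matrix.mul_assoc]
      _ = Φ := by rw [h1, h2, Matrix.one_mul, Matrix.mul_one]

/-- `H` equals `H'` up to conjugation. The ambient groups are general linear groups of the
same size whose rows and columns may be labelled by different index types, so a relabelling
`e` comes first. -/
def IsConjTo [Ring K] (H : Subgroup (GL ι K)) (H' : Subgroup (GL ι' K)) : Prop :=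
  ∃ (e : ι' ≃ ι) (P : GL ι K),
    H = (H'.map (Units.map (Matrix.reindexRingEquiv K e : Matrix ι' ι' K →* Matrix ι ι K))).map
      (MulAut.conj P).toMonoidHom

end Groups

section Matrices

variable (K : Type*) [Ring K]

/-- The matrix `diag(-1, …, -1, 1, …, 1)` with `p` entries `-1` and `q` entries `1`. -/
def signMat (p q : ℕ) : Matrix (Fin p ⊕ Fin q) (Fin p ⊕ Fin q) K :=
  Matrix.fromBlocks (-1) 0 0 1

/-- The matrix with block rows `(0, -1)` and `(1, 0)`, with blocks of size `m`. -/
def sympMat (m : ℕ) : Matrix (Fin m ⊕ Fin m) (Fin m ⊕ Fin m) K :=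
  Matrix.fromBlocks 0 (-1) 1 0

end Matrices

/-- `O(p, q)` -/
noncomputable def O (p q : ℕ) : Subgroup (GL (Fin p ⊕ Fin q) ℝ) := bilinIsom (signMat ℝ p q)

/-- `Sp(m, ℝ)`, acting on `ℝ^(2m)` -/
noncomputable def SpR (m : ℕ) : Subgroup (GL (Fin m ⊕ Fin m) ℝ) := bilinIsom (sympMat ℝ m)

/-- `O(m, ℂ)`, acting on `ℂ^m` -/
noncomputable def OC (m : ℕ) : Subgroup (GL (Fin m) ℂ) := bilinIsom (1 : Matrix (Fin m) (Fin m) ℂ)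

/-- `Sp(m, ℂ)`, acting on `ℂ^(2m)` -/
noncomputable def SpC (m : ℕ) : Subgroup (GL (Fin m ⊕ Fin m) ℂ) := bilinIsom (sympMat ℂ m)

/-- `U(r, s)`, acting on `ℂ^(r+s)` -/
noncomputable def U (r s : ℕ) : Subgroup (GL (Fin r ⊕ Fin s) ℂ) := sesqIsom (signMat ℂ r s)

/-- `Sp(r, s)`, acting on `ℍ^(r+s)` -/
noncomputable def SpH (r s : ℕ) : Subgroup (GL (Fin r ⊕ Fin s) (Quaternion ℝ)) :=
  sesqIsom (signMat (Quaternion ℝ) r s)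

/-- The quaternion unit `i`. -/
noncomputable def quatI : Quaternion ℝ := ⟨0, 1, 0, 0⟩

/-- `O*(m)`, acting on `ℍ^m`: the isometry group of the skew-Hermitian form `i 1`. -/
noncomputable def OStar (m : ℕ) : Subgroup (GL (Fin m) (Quaternion ℝ)) :=
  sesqIsom (Matrix.diagonal fun _ => quatI)

section Embeddings

variable (ι : Type*) [Fintype ι] [DecidableEq ι]

/-- The ring homomorphism `A + iB ↦ (A, -B; B, A)` from complex to real matrices. -/
noncomputable def complexToRealMat : Matrix ι ι ℂ →+* Matrix (ι ⊕ ι) (ι ⊕ ι) ℝ where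
  toFun A := Matrix.fromBlocks (A.map Complex.re) (-A.map Complex.im)
    (A.map Complex.im) (A.map Complex.re)
  map_one' := by
    ext (i | i) (j | j) <;> by_cases h : i = j <;> simp [Matrix.one_apply, h]
  map_mul' A B := by
    ext (i | i) (j | j) <;>
      simp [Matrix.mul_apply, Finset.sum_add_distrib, sub_eq_add_neg, add_comm]
  map_zero' := by
    ext (i | i) (j | j) <;> simp
  map_add' A B := by
    ext (i | i) (j | j) <;> simp [add_comm]

/-- For `q = u + v j` with `u, v` complex, the complex number `u`. -/
noncomputable def quatU : Quaternion ℝ →+ ℂ where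
  toFun q := ⟨q.re, q.imI⟩
  map_zero' := rfl
  map_add' _ _ := rfl

/-- For `q = u + v j` with `u, v` complex, the complex number `v`. -/
noncomputable def quatV : Quaternion ℝ →+ ℂ where
  toFun q := ⟨q.imJ, q.imK⟩
  map_zero' := rfl
  map_add' _ _ := rfl

theorem quatU_one : quatU 1 = 1 := rfl

theorem quatV_one : quatV 1 = 0 := rfl

theorem quatU_mul (p q : Quaternion ℝ) :
    quatU (p * q) = quatU p * quatU q - quatV p * star (quatV q) := by
  apply Complex.ext
  · have h : (p * q).re =
        p.re * q.re - p.imI * q.imI - (p.imJ * q.imJ - p.imK * (-q.imK)) := by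
      rw [Quaternion.re_mul]; ring
    exact h
  · have h : (p * q).imI =
        p.re * q.imI + p.imI * q.re - (p.imJ * (-q.imK) + p.imK * q.imJ) := by
      rw [Quaternion.imI_mul]; ring
    exact h

theorem quatV_mul (p q : Quaternion ℝ) :
    quatV (p * q) = quatU p * quatV q + quatV p * star (quatU q) := by
  apply Complex.ext
  · have h : (p * q).imJ =
        p.re * q.imJ - p.imI * q.imK + (p.imJ * q.re - p.imK * (-q.imI)) := by
      rw [Quaternion.imJ_mul]; ring
    exact h
  · have h : (p * q).imK =
        p.re * q.imK + p.imI * q.imJ + (p.imJ * (-q.imI) + p.imK * q.re) := by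
      rw [Quaternion.imK_mul]; ring
    exact h

/-- The ring homomorphism `U + V j ↦ (U, -V; conj V, conj U)` from quaternionic to complex
matrices. -/
noncomputable def quaternionToComplexMat : Matrix ι ι (Quaternion ℝ) →+* Matrix (ι ⊕ ι) (ι ⊕ ι) ℂ where
  toFun A := Matrix.fromBlocks (A.map quatU) (-A.map quatV)
    (A.map fun q => star (quatV q)) (A.map fun q => star (quatU q))
  map_one' := by
    ext (i | i) (j | j) <;> by_cases h : i = j <;>
      simp [Matrix.one_apply, h, quatU_one, quatV_one]
  map_mul' A B := by
    ext (i | i) (j | j) <;>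
      simp [Matrix.mul_apply, quatU_mul, quatV_mul, map_sum, Finset.sum_add_distrib,
        Finset.sum_sub_distrib, mul_comm] <;> ring
  map_zero' := by
    ext (i | i) (j | j) <;> simp
  map_add' A B := by
    ext (i | i) (j | j) <;> simp [add_comm]

/-- The embedding of `GL(m, ℂ)` into `GL(2m, ℝ)`. -/
noncomputable def complexToReal : GL ι ℂ →* GL (ι ⊕ ι) ℝ :=
  Units.map (complexToRealMat ι : Matrix ι ι ℂ →* Matrix (ι ⊕ ι) (ι ⊕ ι) ℝ)

/-- The embedding of `GL(m, ℍ)` into `GL(2m, ℂ)`. -/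
noncomputable def quaternionToComplex : GL ι (Quaternion ℝ) →* GL (ι ⊕ ι) ℂ :=
  Units.map (quaternionToComplexMat ι :
    Matrix ι ι (Quaternion ℝ) →* Matrix (ι ⊕ ι) (ι ⊕ ι) ℂ)

/-- The embedding of `GL(m, ℍ)` into `GL(4m, ℝ)`. -/
noncomputable def quaternionToReal : GL ι (Quaternion ℝ) →* GL ((ι ⊕ ι) ⊕ (ι ⊕ ι)) ℝ :=
  (complexToReal (ι ⊕ ι)).comp (quaternionToComplex ι)

end Embeddings

section Representations

/-- The representation on `ℝⁿ` given by a homomorphism to `GL(n, ℝ)`. -/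
noncomputable def matRep {G : Type*} [Group G] {n : ℕ} (κ : G →* GL (Fin n) ℝ) :
    Representation ℝ G (Fin n → ℝ) where
  toFun g := Matrix.toLin' (κ g : Matrix (Fin n) (Fin n) ℝ)
  map_one' := by simp [Module.End.one_eq_id]
  map_mul' g h := by simp [Matrix.toLin'_mul, Module.End.mul_eq_comp]

variable {G V : Type*} [Group G] [AddCommGroup V] [Module ℝ V]

/-- A representation is self-dual if it is isomorphic to its dual representation. -/
def IsSelfDual (ρ : Representation ℝ G V) : Prop :=
  Nonempty (Representation.Equiv ρ ρ.dual)

/-- The space of invariant symmetric bilinear forms. -/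
def symForms (ρ : Representation ℝ G V) : Submodule ℝ (LinearMap.BilinForm ℝ V) where
  carrier := {b | (∀ g x y, b (ρ g x) (ρ g y) = b x y) ∧ ∀ x y, b x y = b y x}
  zero_mem' := by simp
  add_mem' := by
    rintro a b ⟨ha, ha'⟩ ⟨hb, hb'⟩
    exact ⟨fun g x y => by simp [ha, hb],
      fun x y => by rw [LinearMap.add_apply, LinearMap.add_apply, LinearMap.add_apply,
        LinearMap.add_apply, ha' x y, hb' x y]⟩
  smul_mem' := by
    rintro c b ⟨hb, hb'⟩
    exact ⟨fun g x y => by simp [hb], fun x y => by simp [hb' x y]⟩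

/-- The space of invariant skew-symmetric bilinear forms. -/
def skewForms (ρ : Representation ℝ G V) : Submodule ℝ (LinearMap.BilinForm ℝ V) where
  carrier := {b | (∀ g x y, b (ρ g x) (ρ g y) = b x y) ∧ ∀ x y, b x y = -b y x}
  zero_mem' := by simp
  add_mem' := by
    rintro a b ⟨ha, ha'⟩ ⟨hb, hb'⟩
    exact ⟨fun g x y => by simp [ha, hb],
      fun x y => by
        rw [LinearMap.add_apply, LinearMap.add_apply, LinearMap.add_apply,
          LinearMap.add_apply, ha' x y, hb' x y]
        ring⟩
  smul_mem' := by
    rintro c b ⟨hb, hb'⟩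
    exact ⟨fun g x y => by simp [hb], fun x y => by simp [hb' x y]⟩

/-- The algebra of invariant endomorphisms of `ρ` is isomorphic to the real algebra `D`, and
the spaces of invariant symmetric and skew-symmetric bilinear forms have dimensions `a`, `b`. -/
def HasType (ρ : Representation ℝ G V) (D : Type) [Ring D] [Algebra ℝ D] (a b : ℕ) : Prop :=
  Nonempty (Representation.IntertwiningMap ρ ρ ≃ₐ[ℝ] D) ∧
    Module.finrank ℝ (symForms ρ) = a ∧ Module.finrank ℝ (skewForms ρ) = b

/-- Up to conjugation in `GL(n, ℝ)`, the image of `κ` is contained in `L`. -/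
def ImageInConj {n : ℕ} {ι : Type*} [Fintype ι] [DecidableEq ι] (κ : G →* GL (Fin n) ℝ)
    (L : Subgroup (GL ι ℝ)) : Prop :=
  ∃ L' : Subgroup (GL (Fin n) ℝ), IsConjTo L' L ∧ κ.range ≤ L'

end Representations

end ClassicalGroups

/-! By Schur's lemma the commutant `D` of an irreducible representation is a finite-dimensional real
algebra without zero divisors, so by Frobenius it is ℝ, ℂ or ℍ, and `V` becomes a `D`-vector space.
Self-duality yields a nonzero invariant form `b`, which is nondegenerate because its kernel is
invariant. Every other invariant form is `b (d • x) y` for a unique `d : D`.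

Averaging over the units of `D` and symmetrizing makes `b` symmetric or skew, with adjoint `σ` on
`D` equal to the identity or to conjugation (`exists_complex_form`, `exists_quaternion_form`). The
symmetric and the skew forms then correspond to eigenspaces of `σ`, which gives the dimensions
(`ActsAsCommutant.finrank_forms`).

To identify the group, `b` is brought to normal form in a `D`-basis. The form stays real-valued: the
functionals `d ↦ b x (d • y)` carry the information of a `D`-valued form, so one orthogonalization
argument (`exists_basis_orthogonal_blocks`) serves all cases. In the underlying real basis every `κ
g` preserves a standard Gram matrix and commutes with `D`. The bounds `4 ≤ n` and `8 ≤ n` hold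
because O(1, ℂ) = {±1} preserves real lines and O*(1) = U(1) preserves a real plane.

For the intersections, the embedded linear groups are described by commutation with a complex or
quaternionic structure. Preserving two forms amounts to preserving one of them and commuting with
the quotient of the two, which is such a structure. -/

namespace ClassicalGroups

/-! ### Frobenius' theorem on real division algebras -/

section Frobenius

variable {E : Type*} [Ring E] [Algebra ℝ E]

theorem exists_smul_mul_self_eq_neg_one {x : E} {c : ℝ} (hc : c < 0)
    (h : x ^ 2 = algebraMap ℝ E c) : ((√(-c))⁻¹ • x) * ((√(-c))⁻¹ • x) = -1 := by
  rw [smul_mul_smul_comm, ← sq x, h, ← mul_inv, Real.mul_self_sqrt (by linarith),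
    Algebra.algebraMap_eq_smul_one, smul_smul, inv_neg, neg_mul, inv_mul_cancel₀ hc.ne]
  simp

variable [IsDomain E]

open Polynomial in
/-- Every element of a finite-dimensional real domain solves a quadratic equation over `ℝ`. -/
theorem exists_sub_sq_eq_algebraMap [FiniteDimensional ℝ E] (x : E) :
    ∃ a c : ℝ, (x - algebraMap ℝ E a) ^ 2 = algebraMap ℝ E c := by
  have hx : IsIntegral ℝ x := Algebra.IsIntegral.isIntegral x
  have hmon := minpoly.monic hx
  have hdeg : (minpoly ℝ x).degree ≤ 2 := (minpoly.irreducible hx).degree_le_two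
  have key : ∃ a c : ℝ, minpoly ℝ x ∣ (X - C a) ^ 2 - C c := by
    have hq := eq_quadratic_of_degree_le_two hdeg
    set u := (minpoly ℝ x).coeff 2
    set v := (minpoly ℝ x).coeff 1
    set w := (minpoly ℝ x).coeff 0
    have hpos := minpoly.natDegree_pos hx
    have hle : (minpoly ℝ x).natDegree ≤ 2 := natDegree_le_of_degree_le hdeg
    obtain h1 | h2 : (minpoly ℝ x).natDegree = 1 ∨ (minpoly ℝ x).natDegree = 2 := by omega
    · have hu : u = 0 := coeff_eq_zero_of_natDegree_lt (by omega)
      have hv : v = 1 := by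
        have := hmon.coeff_natDegree
        rwa [h1] at this
      refine ⟨-w, 0, X + C w, ?_⟩
      rw [hq, hu, hv]
      simp only [map_zero, map_one, map_neg]
      ring
    · have hu : u = 1 := by
        have := hmon.coeff_natDegree
        rwa [h2] at this
      -- Completing the square in the quadratic minimal polynomial.
      obtain ⟨t, ht⟩ : ∃ t, v = 2 * t := ⟨v / 2, by ring⟩
      refine ⟨-t, t ^ 2 - w, 1, ?_⟩
      rw [hq, hu]
      rw [ht]
      simp only [map_one, map_neg, map_sub, map_pow, map_mul, map_ofNat]
      ring
  obtain ⟨a, c, p, hp⟩ := key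
  refine ⟨a, c, ?_⟩
  have := congrArg (aeval x) hp
  simpa [sub_eq_zero] using this

/-- In a domain `x ^ 2 - c` factors as `(x - √c) * (x + √c)`, so one factor vanishes. -/
theorem mem_range_of_sq_eq_nonneg {x : E} {c : ℝ} (hc : 0 ≤ c) (h : x ^ 2 = algebraMap ℝ E c) :
    ∃ a : ℝ, x = algebraMap ℝ E a := by
  have h0 : (x - algebraMap ℝ E √c) * (x + algebraMap ℝ E √c) = 0 := by
    have h1 : algebraMap ℝ E √c * algebraMap ℝ E √c = algebraMap ℝ E c := by
      rw [← map_mul, Real.mul_self_sqrt hc]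
    have h2 := Algebra.commutes √c x
    rw [sub_mul, mul_add, mul_add, h1, ← sq, h, h2]
    abel
  rcases mul_eq_zero.mp h0 with h | h
  · exact ⟨_, sub_eq_zero.mp h⟩
  · exact ⟨-√c, by rw [map_neg]; exact eq_neg_of_add_eq_zero_left h⟩

/-- The centralizer of `i` is ℝ + ℝi. After a real shift `x` becomes `y` with `y ^ 2 = c`. If `c ≤
0` and `s = √(-c)`, then `(y - s * i) * (y + s * i) = y ^ 2 - c = 0`, since `y` commutes with `i`.
-/
theorem eq_add_mul_of_commute [FiniteDimensional ℝ E] {i x : E} (hi : i * i = -1)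
    (h : i * x = x * i) : ∃ a b : ℝ, x = algebraMap ℝ E a + algebraMap ℝ E b * i := by
  obtain ⟨a, c, hc⟩ := exists_sub_sq_eq_algebraMap x
  rcases le_total 0 c with h0 | h0
  · obtain ⟨b, hb⟩ := mem_range_of_sq_eq_nonneg h0 hc
    exact ⟨a + b, 0, by rw [map_add, map_zero, zero_mul, add_zero, ← hb]; abel⟩
  · set y := x - algebraMap ℝ E a with hy
    set s := algebraMap ℝ E √(-c) with hs
    have hs2 : s * s = -algebraMap ℝ E c := by
      rw [hs, ← map_mul, Real.mul_self_sqrt (by linarith), map_neg]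
    have hsy : s * y = y * s := Algebra.commutes _ _
    have hsi : s * i = i * s := Algebra.commutes _ _
    have hiy : i * y = y * i := by
      rw [hy, mul_sub, sub_mul, h, Algebra.commutes]
    have h1 : (y - s * i) * (y + s * i) = 0 := by
      have e1 : s * i * y = y * (s * i) := by rw [mul_assoc, hiy, ← mul_assoc, hsy, mul_assoc]
      have e2 : s * i * (s * i) = algebraMap ℝ E c := by
        rw [hsi, mul_assoc, ← hsi, ← mul_assoc s, hs2, neg_mul, Algebra.commutes, mul_neg,
          ← mul_assoc, hi]
        simp
      rw [sub_mul, mul_add, mul_add, e1, e2, ← sq, hc]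
      abel
    rcases mul_eq_zero.mp h1 with h2 | h2
    · exact ⟨a, √(-c), by rw [← hs, ← sub_eq_zero.mp h2, hy]; abel⟩
    · refine ⟨a, -√(-c), ?_⟩
      rw [map_neg, ← hs, neg_mul, ← eq_neg_of_add_eq_zero_left h2, hy]; abel

/-- **Frobenius' theorem** on finite-dimensional real division algebras. -/
theorem frobenius_real [FiniteDimensional ℝ E] :
    Nonempty (E ≃ₐ[ℝ] ℝ) ∨ Nonempty (E ≃ₐ[ℝ] ℂ) ∨ Nonempty (E ≃ₐ[ℝ] Quaternion ℝ) := by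
  by_cases hR : ∀ x : E, ∃ a : ℝ, x = algebraMap ℝ E a
  · left
    exact ⟨(AlgEquiv.ofBijective (Algebra.ofId ℝ E)
      ⟨(algebraMap ℝ E).injective, fun x => (hR x).imp fun _ h => h.symm⟩).symm⟩
  right
  push Not at hR
  obtain ⟨x, hx⟩ := hR
  obtain ⟨i, hi⟩ : ∃ i : E, i * i = -1 := by
    obtain ⟨a, c, hc⟩ := exists_sub_sq_eq_algebraMap x
    rcases le_or_gt 0 c with h0 | h0
    · obtain ⟨b, hb⟩ := mem_range_of_sq_eq_nonneg h0 hc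
      exact absurd (by rw [map_add, ← hb]; abel) (hx (a + b))
    · exact ⟨_, exists_smul_mul_self_eq_neg_one h0 hc⟩
  by_cases hC : ∀ y : E, i * y = y * i
  · left
    refine ⟨(AlgEquiv.ofBijective (Complex.liftAux i hi)
      ⟨(Complex.liftAux i hi).toRingHom.injective, fun y => ?_⟩).symm⟩
    obtain ⟨a, b, h⟩ := eq_add_mul_of_commute hi (hC y)
    refine ⟨⟨a, b⟩, ?_⟩
    rw [Complex.liftAux_apply, h, Algebra.smul_def]
  right
  push Not at hC
  obtain ⟨y, hy⟩ := hC
  -- The commutator `z = i * y - y * i` anticommutes with `i`, so `z ^ 2` commutes with `i` and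
  -- equals `a + b i`. As `z` commutes with its square, `b = 0`. If `a ≥ 0`, then `z` would be real
  -- and commute with `i`; hence `a < 0` and `z` can be scaled to `j`.
  obtain ⟨j, hj, hij⟩ : ∃ j : E, j * j = -1 ∧ i * j = -(j * i) := by
    have h2 : (2 : E) ≠ 0 := by
      have := (algebraMap ℝ E).injective.ne (show (2 : ℝ) ≠ 0 by norm_num)
      rwa [map_ofNat, map_zero] at this
    set z := i * y - y * i with hz
    have hz0 : z ≠ 0 := sub_ne_zero.mpr hy
    have hiz : i * z = -(z * i) := by
      rw [hz, mul_sub, sub_mul, ← mul_assoc, hi, mul_assoc y, hi, ← mul_assoc]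
      simp only [neg_one_mul, mul_neg_one]
      abel
    obtain ⟨a, b, hab⟩ := eq_add_mul_of_commute (x := z ^ 2) hi (by
      rw [sq, ← mul_assoc, hiz, neg_mul, mul_assoc, hiz, mul_neg, neg_neg, mul_assoc])
    have hb : algebraMap ℝ E b * (i * z) = 0 := by
      have h1 : z * z ^ 2 = z ^ 2 * z := by rw [← pow_succ', ← pow_succ]
      rw [hab, mul_add, add_mul, ← Algebra.commutes a z, add_right_inj, ← mul_assoc,
        ← Algebra.commutes b z, mul_assoc, mul_assoc, ← neg_eq_iff_eq_neg.mpr hiz, mul_neg,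
        neg_eq_iff_add_eq_zero, ← two_mul] at h1
      exact (mul_eq_zero.mp h1).resolve_left h2
    have hi0 : i ≠ 0 := by rintro rfl; simp at hi
    have hb0 := (mul_eq_zero.mp hb).resolve_right (mul_ne_zero hi0 hz0)
    rw [hb0, zero_mul, add_zero] at hab
    rcases le_or_gt 0 a with h0 | h0
    · obtain ⟨t, ht⟩ := mem_range_of_sq_eq_nonneg h0 hab
      have h3 : z * i = i * z := by rw [ht, Algebra.commutes]
      rw [h3, ← add_eq_zero_iff_eq_neg, ← two_mul] at hiz
      exact absurd ((mul_eq_zero.mp hiz).resolve_left h2) (mul_ne_zero hi0 hz0)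
    · refine ⟨_, exists_smul_mul_self_eq_neg_one h0 hab, ?_⟩
      rw [mul_smul_comm, hiz, smul_mul_assoc, smul_neg]
  let q : QuaternionAlgebra.Basis E (-1 : ℝ) 0 (-1) :=
    { i := i, j := j, k := i * j
      i_mul_i := by simp [hi]
      j_mul_j := by simp [hj]
      i_mul_j := rfl
      j_mul_i := by simp [hij] }
  let f : Quaternion ℝ →ₐ[ℝ] E := QuaternionAlgebra.lift q
  refine ⟨(AlgEquiv.ofBijective f ⟨f.toRingHom.injective, fun y => ?_⟩).symm⟩
  have hiq : f ⟨0, 1, 0, 0⟩ = i := by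
    change q.lift _ = i
    simp [QuaternionAlgebra.Basis.lift, q]
  have hjq : f ⟨0, 0, 1, 0⟩ = j := by
    change q.lift _ = j
    simp [QuaternionAlgebra.Basis.lift, q]
  have hrange : ∀ x : E, i * x = x * i → x ∈ f.range := by
    intro x hx
    obtain ⟨a, b, rfl⟩ := eq_add_mul_of_commute hi hx
    exact add_mem (f.range.algebraMap_mem a) (mul_mem (f.range.algebraMap_mem b) ⟨_, hiq⟩)
  have hjr : j ∈ f.range := ⟨_, hjq⟩
  have hir : i ∈ f.range := ⟨_, hiq⟩
  have hii : ∀ x : E, i * (i * x) = -x := fun x => by rw [← mul_assoc, hi, neg_one_mul]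
  -- Up to the factor 2, `y` is the sum of a part commuting with `i` and a part anticommuting with
  -- `i`; the second commutes with `i` after multiplication by `j`.
  have h1 : y - i * y * i ∈ f.range := hrange _ (by
    simp only [mul_sub, sub_mul, mul_assoc, hi, hii, mul_neg, mul_one]
    abel)
  have h2 : y + i * y * i ∈ f.range := by
    have h3 : (y + i * y * i) * j ∈ f.range := hrange _ (by
      have hji' : j * i = -(i * j) := by rw [hij, neg_neg]
      simp only [mul_add, add_mul, mul_assoc, hii, hji', mul_neg]
      abel)
    have h4 := neg_mem (mul_mem h3 hjr)
    rwa [mul_assoc, hj, mul_neg, mul_one, neg_neg] at h4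
  have h5 : (2⁻¹ : ℝ) • ((y - i * y * i) + (y + i * y * i)) = y := by
    rw [sub_add_add_cancel, ← two_smul ℝ y, smul_smul]; norm_num
  rw [← h5]
  exact f.range.smul_mem (add_mem h1 h2) _

end Frobenius

/-! ### Orthogonal decomposition of forms over a division algebra -/

section OrthogonalBlocks

open Module

variable {D V κ : Type*} [DivisionRing D] [AddCommGroup V] [Module ℝ V] [Module D V] [Fintype κ]
  {b : LinearMap.BilinForm ℝ V} {σ : D → D} {ε : ℝ}

/-- The functionals `d ↦ b (x a) (d • x c)` attached to a family `x` of vectors. -/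
def blockGram (b : LinearMap.BilinForm ℝ V) (x : κ → V) : κ → κ → D → ℝ :=
  fun a c d => b (x a) (d • x c)

/-- Nondegeneracy of the Gram functionals of a family of vectors. -/
def IsNondegGram (M : κ → κ → D → ℝ) : Prop :=
  ∀ u : κ → D, (∀ a d, ∑ c, M a c (d * u c) = 0) → u = 0

/-- Pairing a linear relation with the vectors of one block annihilates all the other blocks;
nondegeneracy of the remaining Gram functionals kills the coefficients. -/
theorem linearIndependent_of_orthogonal_blocks {S : Set (κ → V)}
    (hS : ∀ x ∈ S, IsNondegGram (blockGram (D := D) b x))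
    (horth : S.Pairwise fun x y => ∀ a c (d : D), b (x a) (d • y c) = 0) :
    LinearIndependent D (fun p : S × κ => p.1.1 p.2) := by
  classical
  rw [linearIndependent_iff]
  intro l hl
  ext ⟨x, c⟩
  have key := hS x.1 x.2 (fun c => l (x, c)) fun a d => by
    have h1 : ∑ p ∈ l.support, b (x.1 a) ((d * l p) • p.1.1 p.2) = 0 := by
      have := congrArg (fun v => b (x.1 a) (d • v)) hl
      simpa [Finsupp.linearCombination_apply, Finsupp.sum, Finset.smul_sum, smul_smul] using this
    -- The sum over the support is compared with the sum over the whole block of `x` through their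
    -- union: terms of other blocks vanish by orthogonality, terms off the support have coefficient
    -- zero.
    set T : Finset (S × κ) := Finset.univ.map ⟨fun c => (x, c), Prod.mk_right_injective x⟩ with hT
    rw [Finset.sum_subset (Finset.subset_union_left (s₂ := T)),
      ← Finset.sum_subset (Finset.subset_union_right (s₁ := l.support) (s₂ := T)), hT,
      Finset.sum_map] at h1
    · exact h1
    · rintro ⟨y, c⟩ - hp
      have hxy : x ≠ y := by rintro rfl; simp [hT] at hp
      exact horth x.2 y.2 (fun h => hxy (Subtype.ext h)) _ _ _
    · intro p _ hp
      rw [Finsupp.notMem_support_iff.mp hp]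
      simp
  exact congrFun key c

variable [Algebra ℝ D] [IsScalarTower ℝ D V]

/-- The real-linear map sending coefficients `u` to the functionals of `∑ c, u c • x c` goes from `κ
→ D` to `κ → Dual ℝ D`. It is injective by nondegeneracy, and both sides have the same real
dimension. -/
theorem exists_orthogonal_projection [FiniteDimensional ℝ D] {x : κ → V}
    (hM : IsNondegGram (blockGram (D := D) b x)) (y : V) :
    ∃ u : κ → D, ∀ a (d : D), ∑ c, b (x a) (d • u c • x c) = b (x a) (d • y) := by
  let F : V → κ → Dual ℝ D := fun y a =>
    (b (x a)) ∘ₗ (LinearMap.toSpanSingleton D V y).restrictScalars ℝ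
  let Φ : (κ → D) →ₗ[ℝ] (κ → Dual ℝ D) :=
    { toFun := fun u => F (∑ c, u c • x c)
      map_add' := fun u v => by
        ext a d
        simp [F, add_smul, Finset.sum_add_distrib]
      map_smul' := fun r u => by
        ext a d
        simp only [F, Pi.smul_apply, LinearMap.smul_apply, smul_assoc, ← Finset.smul_sum,
          LinearMap.comp_apply, LinearMap.restrictScalars_apply,
          LinearMap.toSpanSingleton_apply, RingHom.id_apply]
        rw [smul_algebra_smul_comm, map_smul] }
  have hinj : Function.Injective Φ := by
    rw [← LinearMap.ker_eq_bot, LinearMap.ker_eq_bot']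
    intro u hu
    refine hM u fun a d => ?_
    have := LinearMap.congr_fun (congrFun hu a) d
    simpa [Φ, F, blockGram, Finset.smul_sum, smul_smul] using this
  have hsurj : Function.Surjective Φ :=
    (LinearMap.injective_iff_surjective_of_finrank_eq_finrank (by
      rw [finrank_pi_fintype, finrank_pi_fintype]
      simp [Subspace.dual_finrank_eq])).mp hinj
  obtain ⟨u, hu⟩ := hsurj (F y)
  refine ⟨u, fun a d => ?_⟩
  have := LinearMap.congr_fun (congrFun hu a) d
  simpa [Φ, F, Finset.smul_sum] using this

/-- A nondegenerate form is an orthogonal sum of blocks in normal form, as soon as every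
nondegenerate nonzero submodule contains such a block. -/
theorem exists_basis_orthogonal_blocks [FiniteDimensional ℝ D] [FiniteDimensional ℝ V]
    [Nonempty κ]
    (hb : ∀ d x y, b (d • x) y = b x (σ d • y)) (hε : ∀ x y, b x y = ε * b y x)
    (hnd : ∀ x, (∀ y, b x y = 0) → x = 0) {N : Set (κ → κ → D → ℝ)}
    (hN : ∀ M ∈ N, IsNondegGram M)
    (hex : ∀ U : Submodule D V, U ≠ ⊥ → (∀ x ∈ U, (∀ y ∈ U, b x y = 0) → x = 0) →
      ∃ x : κ → V, (∀ a, x a ∈ U) ∧ blockGram b x ∈ N) :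
    ∃ (S : Set (κ → V)) (B : Basis (S × κ) D V), S.Finite ∧ (∀ p, B p = p.1.1 p.2) ∧
      (∀ x ∈ S, blockGram b x ∈ N) ∧
      S.Pairwise fun x y => ∀ a c (d : D), b (x a) (d • y c) = 0 := by
  classical
  obtain ⟨S, hS⟩ := zorn_subset {S : Set (κ → V) | (∀ x ∈ S, blockGram b x ∈ N) ∧
      S.Pairwise fun x y => ∀ a c (d : D), b (x a) (d • y c) = 0} (by
    intro C hC hchain
    refine ⟨⋃₀ C, ⟨?_, ?_⟩, fun s hs => Set.subset_sUnion_of_mem hs⟩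
    · rintro x ⟨s, hs, hx⟩
      exact (hC hs).1 x hx
    · rw [Set.pairwise_sUnion hchain.directedOn]
      exact fun s hs => (hC hs).2)
  obtain ⟨⟨hSN, horth⟩, hmax⟩ := hS
  have hli := linearIndependent_of_orthogonal_blocks (fun x hx => hN _ (hSN x hx)) horth
  have : Module.Finite D V := Module.Finite.of_restrictScalars_finite ℝ D V
  have hfin : Finite (S × κ) := hli.finite
  have hSf : Finite S := Finite.of_surjective (Prod.fst : S × κ → S) Prod.fst_surjective
  have := Fintype.ofFinite S
  -- The orthogonal complement of a maximal orthogonal family. Since `V` is spanned by the family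
  -- and `U`, the form is nondegenerate on `U`, and a block inside `U` would enlarge the family
  -- unless `U = ⊥`.
  let U : Submodule D V :=
    { carrier := {y | ∀ x ∈ S, ∀ a (d : D), b (x a) (d • y) = 0}
      zero_mem' := by simp
      add_mem' := fun {y z} hy hz x hx a d => by
        rw [smul_add, map_add, hy x hx, hz x hx, add_zero]
      smul_mem' := fun e y hy x hx a d => by
        rw [smul_smul]; exact hy x hx a _ }
  have hproj : ∀ y, ∃ u : S → κ → D, y - ∑ z, ∑ c, u z c • z.1 c ∈ U := by
    intro y
    choose u hu using fun z : S => exists_orthogonal_projection (hN _ (hSN z.1 z.2)) y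
    refine ⟨u, fun x hx a d => ?_⟩
    rw [smul_sub, map_sub, Finset.smul_sum, map_sum, Finset.sum_eq_single ⟨x, hx⟩, sub_eq_zero,
      Finset.smul_sum, map_sum]
    · exact (hu ⟨x, hx⟩ a d).symm
    · rintro z - hz
      rw [Finset.smul_sum, map_sum]
      refine Finset.sum_eq_zero fun c _ => ?_
      rw [smul_smul]
      exact horth hx z.2 (fun h => hz (Subtype.ext h.symm)) _ _ _
    · simp
  have horth' : ∀ y ∈ U, ∀ x ∈ S, ∀ a (d : D), b y (d • x a) = 0 := by
    intro y hy x hx a d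
    rw [hε, hb, hy x hx, mul_zero]
  have hU : U = ⊥ := by
    by_contra hU
    obtain ⟨x, hxU, hxN⟩ := hex U hU (by
      intro x hx hx0
      refine hnd x fun y => ?_
      obtain ⟨u, hu⟩ := hproj y
      have := hx0 _ hu
      rw [map_sub, sub_eq_zero] at this
      rw [this, map_sum]
      refine Finset.sum_eq_zero fun z _ => ?_
      rw [map_sum]
      exact Finset.sum_eq_zero fun c _ => horth' x hx _ z.2 _ _)
    have hxS : x ∈ S := by
      refine hmax (y := insert x S) ⟨?_, ?_⟩ (Set.subset_insert x S) (Set.mem_insert x S)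
      · rintro z (rfl | hz)
        exacts [hxN, hSN z hz]
      · refine horth.insert fun z hz _ => ⟨fun a c d => ?_, fun a c d => ?_⟩
        · exact horth' _ (hxU a) _ hz _ _
        · exact hxU c z hz a d
    -- By maximality the new block lies in `S`, yet it lies in `U` and is thus orthogonal to itself;
    -- its Gram functionals vanish, so nondegeneracy applied to the constant family `1` gives `1 =
    -- 0`.
    have := hN _ hxN (fun _ => 1) fun a d => Finset.sum_eq_zero fun c _ => hxU c x hxS a _
    exact one_ne_zero (congrFun this (Classical.arbitrary κ))
  refine ⟨S, Basis.mk hli fun y _ => ?_, hSf, fun p => by simp, hSN, horth⟩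
  obtain ⟨u, hu⟩ := hproj y
  rw [hU, Submodule.mem_bot, sub_eq_zero] at hu
  rw [hu]
  exact Submodule.sum_mem _ fun z _ => Submodule.sum_mem _ fun c _ =>
    Submodule.smul_mem _ _ (Submodule.subset_span ⟨(z, c), rfl⟩)

/-- A form that is not alternating over `D` has an orthogonal `D`-basis of vectors in normal
form. -/
theorem exists_orthogonal_basis [FiniteDimensional ℝ D] [FiniteDimensional ℝ V]
    (hb : ∀ d x y, b (d • x) y = b x (σ d • y)) (hε : ∀ x y, b x y = ε * b y x)
    (hnd : ∀ x, (∀ y, b x y = 0) → x = 0) (hσ : ∃ d, d + ε • σ d ≠ 0) {L : Set (D → ℝ)}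
    (hL : ∀ f ∈ L, ∀ u, (∀ d, f (d * u) = 0) → u = 0)
    (hnorm : ∀ v, (∃ d : D, b v (d • v) ≠ 0) → ∃ e : D, (fun d => b (e • v) (d • e • v)) ∈ L) :
    ∃ (m : ℕ) (B : Basis (Fin m) D V),
      (∀ i, (fun d => b (B i) (d • B i)) ∈ L) ∧
      ∀ i j, i ≠ j → ∀ d : D, b (B i) (d • B j) = 0 := by
  obtain ⟨S, B, hfin, hB, hS, horth⟩ := exists_basis_orthogonal_blocks (κ := Unit) hb hε hnd
    (N := (fun f _ _ => f) '' L) (by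
      rintro _ ⟨f, hf, rfl⟩ u hu
      ext a
      exact hL f hf _ fun d => by simpa using hu () d) (by
      intro U hU hnd'
      -- Polarization: if `b v (d • v)` vanishes throughout `U`, then so does `b v ((d + ε • σ d) •
      -- w)`. For the given `d` the scalar is invertible, so `b` vanishes on `U`.
      have h1 : ∃ v ∈ U, ∃ d : D, b v (d • v) ≠ 0 := by
        by_contra! h
        obtain ⟨d, hd⟩ := hσ
        refine hU (U.eq_bot_iff.mpr fun v hv => hnd' v hv fun y hy => ?_)
        have hw : ∀ w ∈ U, b v ((d + ε • σ d) • w) = 0 := by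
          intro w hw
          have h2 := h (v + w) (U.add_mem hv hw) d
          rw [smul_add, map_add, map_add, LinearMap.add_apply, LinearMap.add_apply, h v hv,
            h w hw, zero_add, add_zero, hε w, hb] at h2
          rw [add_smul, map_add, smul_assoc, (b v).map_smul, smul_eq_mul, add_comm]
          exact h2
        have := hw ((d + ε • σ d)⁻¹ • y) (U.smul_mem _ hy)
        rwa [smul_inv_smul₀ hd] at this
      obtain ⟨v, hv, h2⟩ := h1
      obtain ⟨e, he⟩ := hnorm v h2
      exact ⟨fun _ => e • v, fun _ => U.smul_mem _ hv, _, he, rfl⟩)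
  have := hfin.fintype
  let e := Fintype.equivFin (S × Unit)
  refine ⟨_, B.reindex e, fun i => ?_, fun i j hij d => ?_⟩
  · obtain ⟨f, hf, h⟩ := hS _ (e.symm i).1.2
    rw [B.reindex_apply, hB]
    convert hf using 1
    exact (congrFun (congrFun h ()) ()).symm
  · rw [B.reindex_apply, B.reindex_apply, hB, hB]
    exact horth (e.symm i).1.2 (e.symm j).1.2
      (fun h => hij (e.symm.injective (Prod.ext (Subtype.ext h) rfl))) _ _ _

theorem exists_orthogonal_basis_fin [FiniteDimensional ℝ D] [FiniteDimensional ℝ V]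
    (hb : ∀ d x y, b (d • x) y = b x (σ d • y)) (hε : ∀ x y, b x y = ε * b y x)
    (hnd : ∀ x, (∀ y, b x y = 0) → x = 0) (hσ : ∃ d, d + ε • σ d ≠ 0) {f : D → ℝ}
    (hf : ∀ u, (∀ d, f (d * u) = 0) → u = 0)
    (hnorm : ∀ v, (∃ d : D, b v (d • v) ≠ 0) → ∃ e : D, ∀ d, b (e • v) (d • e • v) = f d) :
    ∃ (m : ℕ) (B : Basis (Fin m) D V), (∀ i d, b (B i) (d • B i) = f d) ∧
      ∀ i j, i ≠ j → ∀ d : D, b (B i) (d • B j) = 0 := by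
  obtain ⟨m, B, hB, horth⟩ := exists_orthogonal_basis hb hε hnd hσ (L := {f})
    (by rintro _ rfl; exact hf) (fun v hv => (hnorm v hv).imp fun e he => funext he)
  exact ⟨m, B, fun i d => congrFun (hB i) d, horth⟩

theorem exists_orthogonal_basis_sign [FiniteDimensional ℝ D] [FiniteDimensional ℝ V]
    (hb : ∀ d x y, b (d • x) y = b x (σ d • y)) (hε : ∀ x y, b x y = ε * b y x)
    (hnd : ∀ x, (∀ y, b x y = 0) → x = 0) (hσ : ∃ d, d + ε • σ d ≠ 0) {f : D → ℝ}
    (hf : ∀ u, (∀ d, f (d * u) = 0) → u = 0)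
    (hnorm : ∀ v, (∃ d : D, b v (d • v) ≠ 0) → ∃ e : D, (∀ d, b (e • v) (d • e • v) = f d) ∨
      ∀ d, b (e • v) (d • e • v) = -f d) :
    ∃ (r s : ℕ) (B : Basis (Fin r ⊕ Fin s) D V),
      (∀ i d, b (B (.inl i)) (d • B (.inl i)) = -f d) ∧
      (∀ i d, b (B (.inr i)) (d • B (.inr i)) = f d) ∧
      ∀ i j, i ≠ j → ∀ d : D, b (B i) (d • B j) = 0 := by
  classical
  obtain ⟨m, B, hB, horth⟩ := exists_orthogonal_basis hb hε hnd hσ (L := {f, -f})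
    (by
      rintro _ (rfl | rfl) u hu
      · exact hf u hu
      · exact hf u fun d => neg_eq_zero.mp (hu d))
    (fun v hv => (hnorm v hv).imp fun e he => he.imp funext funext)
  let p : Fin m → Prop := fun i => ∀ d, b (B i) (d • B i) = -f d
  let e : Fin m ≃ Fin (Fintype.card {i : Fin m // p i}) ⊕ Fin (Fintype.card {i : Fin m // ¬p i}) :=
    (Equiv.sumCompl p).symm.trans
      (Equiv.sumCongr (Fintype.equivFin _) (Fintype.equivFin _))
  refine ⟨_, _, B.reindex e, fun i d => ?_, fun i d => ?_, fun i j hij d => ?_⟩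
  · have := ((Fintype.equivFin {i : Fin m // p i}).symm i).2 d
    simpa [e] using this
  · have h1 := ((Fintype.equivFin {i : Fin m // ¬p i}).symm i).2
    rcases hB ((Fintype.equivFin {i : Fin m // ¬p i}).symm i) with h | h
    · simpa [e] using congrFun h d
    · exact absurd (fun d => congrFun h d) h1
  · simpa using horth _ _ (e.symm.injective.ne hij) d

end OrthogonalBlocks

/-! ### Symplectic bases -/

section Darboux

open Module

variable {D V : Type*} [Field D] [Algebra ℝ D] [AddCommGroup V] [Module ℝ V] [Module D V]
  [IsScalarTower ℝ D V] {b : LinearMap.BilinForm ℝ V}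

/-- A nondegenerate alternating form has a symplectic basis. -/
theorem exists_symplectic_basis [FiniteDimensional ℝ D] [FiniteDimensional ℝ V]
    (hb : ∀ (d : D) x y, b (d • x) y = b x (d • y)) (hε : ∀ x y, b x y = -b y x)
    (hnd : ∀ x, (∀ y, b x y = 0) → x = 0) (f : Dual ℝ D) (hf : f ≠ 0) :
    ∃ (m : ℕ) (B : Basis (Fin m ⊕ Fin m) D V),
      (∀ i j (d : D), b (B (.inl i)) (d • B (.inl j)) = 0) ∧
      (∀ i j (d : D), b (B (.inr i)) (d • B (.inr j)) = 0) ∧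
      (∀ i j (d : D), b (B (.inl i)) (d • B (.inr j)) = if i = j then f d else 0) := by
  classical
  have hself : ∀ (v : V) (d : D), b v (d • v) = 0 := fun v d => by
    have := hε v (d • v)
    rw [hb] at this
    linarith
  have hf' : ∀ u : D, (∀ d, f (d * u) = 0) → u = 0 := by
    intro u hu
    by_contra h
    refine hf (LinearMap.ext fun d => ?_)
    simpa [h] using hu (d * u⁻¹)
  -- Gram functionals of a hyperbolic pair; `false` labels the first vector, `true` the second.
  let M : Bool → Bool → D → ℝ := fun a c d =>
    if a = c then 0 else if a = false then f d else -f d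
  obtain ⟨S, B, hfin, hB, hS, horth⟩ := exists_basis_orthogonal_blocks (κ := Bool) (b := b)
    (D := D) (σ := id) (ε := -1) hb (by simpa using hε) hnd (N := {M}) (by
      rintro _ rfl u hu
      ext a
      refine hf' _ fun d => ?_
      have := hu (!a) d
      cases a <;> simpa [M] using this) (by
      intro U hU hnd'
      obtain ⟨v, hv, hv0⟩ := U.exists_mem_ne_zero_of_ne_bot hU
      have : ∃ y ∈ U, b v y ≠ 0 := by
        by_contra! h
        exact hv0 (hnd' v hv h)
      obtain ⟨y, hy, hvy⟩ := this
      -- As `D` is a field, `e ↦ (d ↦ b v (d • e • y))` is injective, hence bijective by dimension.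
      -- A multiple `e • y` therefore pairs with `v` through exactly `f`.
      let F : D →ₗ[ℝ] Dual ℝ D :=
        { toFun := fun e => (b v) ∘ₗ (LinearMap.toSpanSingleton D V (e • y)).restrictScalars ℝ
          map_add' := fun u v => by ext d; simp [add_smul]
          map_smul' := fun r u => by
            ext d
            simp only [LinearMap.comp_apply, LinearMap.restrictScalars_apply,
              LinearMap.toSpanSingleton_apply, RingHom.id_apply, LinearMap.smul_apply, smul_assoc]
            rw [smul_algebra_smul_comm, map_smul] }
      have hinj : Function.Injective F := by
        rw [← LinearMap.ker_eq_bot, LinearMap.ker_eq_bot']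
        intro u hu
        by_contra h
        have := LinearMap.congr_fun hu u⁻¹
        rw [LinearMap.zero_apply] at this
        refine hvy ?_
        simpa [F, smul_smul, h] using this
      obtain ⟨e, he⟩ := ((LinearMap.injective_iff_surjective_of_finrank_eq_finrank
        Subspace.dual_finrank_eq.symm).mp hinj) f
      have he' : ∀ d : D, b v (d • e • y) = f d := fun d => LinearMap.congr_fun he d
      refine ⟨fun a => if a = false then v else e • y, fun a => ?_, ?_⟩
      · cases a
        exacts [hv, U.smul_mem _ hy]
      · rw [Set.mem_singleton_iff]
        ext a c d
        cases a <;> cases c <;> simp [blockGram, M, hself, he']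
        rw [hε, hb, he'])
  have := hfin.fintype
  let e₀ := (Fintype.equivFin S)
  let e : S × Bool ≃ Fin (Fintype.card S) ⊕ Fin (Fintype.card S) :=
    ((Equiv.prodComm _ _).trans (Equiv.boolProdEquivSum S)).trans (Equiv.sumCongr e₀ e₀)
  have hS' : ∀ (x : S) a c (d : D), b (x.1 a) (d • x.1 c) = M a c d := fun x a c d =>
    congrFun (congrFun (congrFun (hS x.1 x.2) a) c) d
  have hgram : ∀ (x y : S) a c (d : D), b (x.1 a) (d • y.1 c) = if x = y then M a c d else 0 := by
    intro x y a c d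
    split_ifs with h
    · rw [h, hS']
    · exact horth x.2 y.2 (fun h' => h (Subtype.ext h')) _ _ _
  refine ⟨_, B.reindex e, fun i j d => ?_, fun i j d => ?_, fun i j d => ?_⟩ <;>
    simp [e, hB, hgram, M]

end Darboux

/-! ### Isometry groups under change of basis -/

section IsometryGroups

variable {ι ι' K : Type*} [Fintype ι] [DecidableEq ι] [Fintype ι'] [DecidableEq ι']

theorem mem_bilinIsom [CommRing K] {Φ : Matrix ι ι K} {A : GL ι K} :
    A ∈ bilinIsom Φ ↔ (A : Matrix ι ι K)ᵀ * Φ * (A : Matrix ι ι K) = Φ := Iff.rfl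

theorem mem_sesqIsom [Ring K] [StarRing K] {Φ : Matrix ι ι K} {A : GL ι K} :
    A ∈ sesqIsom Φ ↔ (A : Matrix ι ι K)ᴴ * Φ * (A : Matrix ι ι K) = Φ := Iff.rfl

theorem bilinIsom_neg [CommRing K] (Φ : Matrix ι ι K) : bilinIsom (-Φ) = bilinIsom Φ := by
  ext A
  simp [mem_bilinIsom]

theorem sesqIsom_smul [Field K] [StarRing K] {c : K} (hc : c ≠ 0) (Φ : Matrix ι ι K) :
    sesqIsom (c • Φ) = sesqIsom Φ := by
  ext A
  simp only [mem_sesqIsom, mul_smul_comm, smul_mul_assoc]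
  exact (smul_right_injective _ hc).eq_iff

theorem mem_map_reindex [Ring K] (e : ι' ≃ ι) (H : Subgroup (GL ι' K)) (X : GL ι K) :
    X ∈ H.map (Units.map (reindexRingEquiv K e : Matrix ι' ι' K →* Matrix ι ι K)) ↔
      Units.map (reindexRingEquiv K e.symm : Matrix ι ι K →* Matrix ι' ι' K) X ∈ H := by
  constructor
  · rintro ⟨A, hA, rfl⟩
    have : Units.map (reindexRingEquiv K e.symm : Matrix ι ι K →* Matrix ι' ι' K)
        (Units.map (reindexRingEquiv K e : Matrix ι' ι' K →* Matrix ι ι K) A) = A := by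
      ext i j
      simp [reindexRingEquiv]
    rw [this]
    exact hA
  · intro h
    refine ⟨_, h, ?_⟩
    ext i j
    simp [reindexRingEquiv]

/-- A congruence `P` between Gram matrices conjugates their isometry groups: `X` preserves `Φ`
exactly when `P⁻¹ * X * P` preserves `Pᵀ * Φ * P`. -/
theorem isConjTo_bilinIsom [CommRing K] {Φ : Matrix ι ι K} {Ψ : Matrix ι' ι' K} (e : ι' ≃ ι)
    (P : GL ι K) (h : (P : Matrix ι ι K)ᵀ * Φ * (P : Matrix ι ι K) = Ψ.submatrix e.symm e.symm) :
    IsConjTo (bilinIsom Φ) (bilinIsom Ψ) := by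
  refine ⟨e, P, ?_⟩
  ext X
  rw [Subgroup.mem_map_equiv, mem_map_reindex, mem_bilinIsom, mem_bilinIsom]
  have hΨ : Ψ = ((P : Matrix ι ι K)ᵀ * Φ * (P : Matrix ι ι K)).submatrix e e := by
    rw [h]; ext i j; simp
  have hY : ((Units.map (reindexRingEquiv K e.symm : Matrix ι ι K →* Matrix ι' ι' K)
      ((MulAut.conj P).symm X) : GL ι' K) : Matrix ι' ι' K) =
      ((P⁻¹ * X * P : GL ι K) : Matrix ι ι K).submatrix e e := rfl
  rw [hY, hΨ, transpose_submatrix, submatrix_mul_equiv, submatrix_mul_equiv]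
  have hinj : Function.Injective fun M : Matrix ι ι K => M.submatrix e e := fun M N h => by
    have := congrArg (fun M => M.submatrix e.symm e.symm) h
    simpa using this
  refine Iff.trans ?_ hinj.eq_iff.symm
  have hP : (P : Matrix ι ι K) * ((P⁻¹ : GL ι K) : Matrix ι ι K) = 1 := P.mul_inv
  have hPt : ((P⁻¹ : GL ι K) : Matrix ι ι K)ᵀ * (P : Matrix ι ι K)ᵀ = 1 := by
    rw [← transpose_mul, hP, transpose_one]
  have hPt' : (P : Matrix ι ι K)ᵀ * ((P⁻¹ : GL ι K) : Matrix ι ι K)ᵀ = 1 := by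
    rw [← transpose_mul, P.inv_mul, transpose_one]
  have e1 : ((P⁻¹ * X * P : GL ι K) : Matrix ι ι K)ᵀ *
      ((P : Matrix ι ι K)ᵀ * Φ * (P : Matrix ι ι K)) * ((P⁻¹ * X * P : GL ι K) : Matrix ι ι K) =
      (P : Matrix ι ι K)ᵀ * ((X : Matrix ι ι K)ᵀ * Φ * X) * P := by
    simp only [Units.val_mul, transpose_mul]
    calc _ = (P : Matrix ι ι K)ᵀ * ((X : Matrix ι ι K)ᵀ *
          ((((P⁻¹ : GL ι K) : Matrix ι ι K)ᵀ * (P : Matrix ι ι K)ᵀ) * Φ *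
          ((P : Matrix ι ι K) * ((P⁻¹ : GL ι K) : Matrix ι ι K))) * X) * P := by
            simp only [Matrix.mul_assoc]
      _ = _ := by rw [hP, hPt, Matrix.one_mul, Matrix.mul_one]
  rw [e1]
  refine ⟨fun hX => by rw [hX], fun hX => ?_⟩
  have := congrArg (fun M => ((P⁻¹ : GL ι K) : Matrix ι ι K)ᵀ * M *
    ((P⁻¹ : GL ι K) : Matrix ι ι K)) hX
  have e2 : ∀ M : Matrix ι ι K, ((P⁻¹ : GL ι K) : Matrix ι ι K)ᵀ *
      ((P : Matrix ι ι K)ᵀ * M * (P : Matrix ι ι K)) * ((P⁻¹ : GL ι K) : Matrix ι ι K) = M := by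
    intro M
    calc _ = (((P⁻¹ : GL ι K) : Matrix ι ι K)ᵀ * (P : Matrix ι ι K)ᵀ) * M *
          ((P : Matrix ι ι K) * ((P⁻¹ : GL ι K) : Matrix ι ι K)) := by
            simp only [Matrix.mul_assoc]
      _ = M := by rw [hP, hPt, Matrix.one_mul, Matrix.mul_one]
  simpa only [e2] using this

theorem isConjTo_sesqIsom [Ring K] [StarRing K] {Φ : Matrix ι ι K} {Ψ : Matrix ι' ι' K}
    (e : ι' ≃ ι) (h : Ψ = Φ.submatrix e e) : IsConjTo (sesqIsom Φ) (sesqIsom Ψ) := by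
  refine ⟨e, 1, ?_⟩
  ext X
  rw [Subgroup.mem_map_equiv, mem_map_reindex, mem_sesqIsom, mem_sesqIsom]
  have hY : ((Units.map (reindexRingEquiv K e.symm : Matrix ι ι K →* Matrix ι' ι' K)
      ((MulAut.conj 1).symm X) : GL ι' K) : Matrix ι' ι' K) =
      (X : Matrix ι ι K).submatrix e e := by
    rw [map_one]; rfl
  rw [hY, h, conjTranspose_submatrix, submatrix_mul_equiv, submatrix_mul_equiv]
  have hinj : Function.Injective fun M : Matrix ι ι K => M.submatrix e e := fun M N h => by
    have := congrArg (fun M => M.submatrix e.symm e.symm) h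
    simpa using this
  exact hinj.eq_iff.symm

/-- The bijection between `{0, …, 2m-1}` and two copies of `{0, …, m-1}`. -/
def finTwoMulEquiv (m : ℕ) : Fin (2 * m) ≃ Fin m ⊕ Fin m :=
  (finCongr (two_mul m)).trans finSumFinEquiv.symm

end IsometryGroups

/-! ### Embeddings of complex and quaternionic matrices -/

section Embeddings

variable {ι : Type*} [Fintype ι] [DecidableEq ι]

theorem complexToRealMat_injective : Function.Injective (complexToRealMat ι) := by
  intro A B h
  ext i j
  have h1 := congrFun (congrFun h (.inl i)) (.inl j)
  have h2 := congrFun (congrFun h (.inr i)) (.inl j)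
  exact Complex.ext h1 h2

theorem quaternionToComplexMat_injective : Function.Injective (quaternionToComplexMat ι) := by
  intro A B h
  ext i j
  · exact congrArg Complex.re (congrFun (congrFun h (.inl i)) (.inl j))
  · exact congrArg Complex.im (congrFun (congrFun h (.inl i)) (.inl j))
  · have := congrArg Complex.re (congrFun (congrFun h (.inr i)) (.inl j))
    exact this
  · have := congrArg Complex.im (congrFun (congrFun h (.inr i)) (.inl j))
    exact neg_injective this

theorem complexToReal_injective : Function.Injective (complexToReal ι) :=
  Units.map_injective complexToRealMat_injective

theorem quaternionToComplex_injective : Function.Injective (quaternionToComplex ι) :=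
  Units.map_injective quaternionToComplexMat_injective

theorem coe_complexToReal (A : GL ι ℂ) :
    (complexToReal ι A : Matrix (ι ⊕ ι) (ι ⊕ ι) ℝ) = complexToRealMat ι A := rfl

theorem coe_quaternionToComplex (A : GL ι (Quaternion ℝ)) :
    (quaternionToComplex ι A : Matrix (ι ⊕ ι) (ι ⊕ ι) ℂ) = quaternionToComplexMat ι A := rfl

theorem complexToRealMat_apply (A : Matrix ι ι ℂ) : complexToRealMat ι A =
    fromBlocks (A.map Complex.re) (-A.map Complex.im) (A.map Complex.im) (A.map Complex.re) := rfl

theorem quaternionToComplexMat_apply (A : Matrix ι ι (Quaternion ℝ)) :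
    quaternionToComplexMat ι A = fromBlocks (A.map quatU) (-A.map quatV)
      (A.map fun q => star (quatV q)) (A.map fun q => star (quatU q)) := rfl

/-- This is why sesquilinear forms over ℂ become bilinear forms over ℝ. -/
theorem complexToRealMat_conjTranspose (A : Matrix ι ι ℂ) :
    complexToRealMat ι Aᴴ = (complexToRealMat ι A)ᵀ := by
  simp only [complexToRealMat_apply]
  ext (i | i) (j | j) <;> simp

theorem quatU_apply (q : Quaternion ℝ) : quatU q = ⟨q.re, q.imI⟩ := rfl

theorem quatV_apply (q : Quaternion ℝ) : quatV q = ⟨q.imJ, q.imK⟩ := rfl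

theorem quatU_star (q : Quaternion ℝ) : quatU (star q) = star (quatU q) := by
  apply Complex.ext <;> simp [quatU_apply]

theorem quatV_star (q : Quaternion ℝ) : quatV (star q) = -quatV q := by
  apply Complex.ext <;> simp [quatV_apply]

theorem quaternionToComplexMat_conjTranspose (A : Matrix ι ι (Quaternion ℝ)) :
    quaternionToComplexMat ι Aᴴ = (quaternionToComplexMat ι A)ᴴ := by
  simp only [quaternionToComplexMat_apply]
  ext (i | i) (j | j) <;> simp [quatU_star, quatV_star]

theorem complexToReal_mem_bilinIsom {Φ : Matrix ι ι ℂ} {A : GL ι ℂ} :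
    complexToReal ι A ∈ bilinIsom (complexToRealMat ι Φ) ↔ A ∈ sesqIsom Φ := by
  rw [mem_bilinIsom, mem_sesqIsom, coe_complexToReal, ← complexToRealMat_conjTranspose,
    ← map_mul, ← map_mul, complexToRealMat_injective.eq_iff]

theorem quaternionToComplex_mem_sesqIsom {Φ : Matrix ι ι (Quaternion ℝ)}
    {A : GL ι (Quaternion ℝ)} :
    quaternionToComplex ι A ∈ sesqIsom (quaternionToComplexMat ι Φ) ↔ A ∈ sesqIsom Φ := by
  rw [mem_sesqIsom, mem_sesqIsom, coe_quaternionToComplex,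
    ← quaternionToComplexMat_conjTranspose, ← map_mul, ← map_mul,
    quaternionToComplexMat_injective.eq_iff]

/-- The matrix `diag(1, -1)` is complex conjugation in real coordinates. -/
theorem complexToRealMat_mul_conj (A : Matrix ι ι ℂ) :
    complexToRealMat ι A * fromBlocks 1 0 0 (-1) =
      fromBlocks 1 0 0 (-1) * complexToRealMat ι (A.map star) := by
  simp only [complexToRealMat_apply, fromBlocks_multiply]
  congr 1 <;> ext <;> simp

/-- The real matrix is the Gram matrix of the real part of the complex bilinear form. Moving the
conjugation `diag(1, -1)` past the image of `Aᴴ` turns it into the image of `Aᵀ`. -/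
theorem complexToReal_mem_bilinIsom_conj {Φ : Matrix ι ι ℂ} {A : GL ι ℂ} :
    complexToReal ι A ∈ bilinIsom (fromBlocks 1 0 0 (-1) * complexToRealMat ι Φ) ↔
      A ∈ bilinIsom Φ := by
  rw [mem_bilinIsom, mem_bilinIsom, coe_complexToReal, ← complexToRealMat_conjTranspose,
    ← Matrix.mul_assoc, complexToRealMat_mul_conj, conjTranspose, Matrix.map_map]
  have hs : (fun z : ℂ => star z) ∘ (fun z : ℂ => star z) = id := by ext z; simp
  have h1 : (fromBlocks 1 0 0 (-1) : Matrix (ι ⊕ ι) (ι ⊕ ι) ℝ) * fromBlocks 1 0 0 (-1) = 1 := by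
    simp [fromBlocks_multiply]
  have h2 : Function.Injective fun M : Matrix (ι ⊕ ι) (ι ⊕ ι) ℝ =>
      fromBlocks 1 0 0 (-1) * M := fun M N h => by
    have := congrArg (fun M => fromBlocks 1 0 0 (-1) * M) h
    simpa only [← Matrix.mul_assoc, h1, Matrix.one_mul] using this
  rw [show (star ∘ star : ℂ → ℂ) = id from hs, Matrix.map_id, Matrix.mul_assoc, Matrix.mul_assoc,
    h2.eq_iff, ← Matrix.mul_assoc, ← map_mul, ← map_mul, complexToRealMat_injective.eq_iff]

theorem complexToRealMat_mul_J (A : Matrix ι ι ℂ) :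
    complexToRealMat ι A * J ι ℝ = J ι ℝ * complexToRealMat ι A := by
  simp [complexToRealMat_apply, J, fromBlocks_multiply]

/-- `J` is multiplication by `i`, and complex-linear means commuting with it. The inverse of `X`
commutes with `J` too, so the complex matrix found is invertible. -/
theorem mem_range_complexToReal {X : GL (ι ⊕ ι) ℝ} :
    X ∈ (complexToReal ι).range ↔
      (X : Matrix (ι ⊕ ι) (ι ⊕ ι) ℝ) * J ι ℝ = J ι ℝ * (X : Matrix (ι ⊕ ι) (ι ⊕ ι) ℝ) := by
  constructor
  · rintro ⟨A, rfl⟩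
    exact complexToRealMat_mul_J _
  · have key : ∀ M : Matrix (ι ⊕ ι) (ι ⊕ ι) ℝ, M * J ι ℝ = J ι ℝ * M →
        ∃ A, complexToRealMat ι A = M := by
      intro M h
      rw [← fromBlocks_toBlocks M, J, fromBlocks_multiply, fromBlocks_multiply,
        fromBlocks_inj] at h
      simp only [Matrix.mul_zero, zero_add, Matrix.mul_one, Matrix.zero_mul, Matrix.one_mul,
        add_zero, Matrix.mul_neg, Matrix.neg_mul] at h
      obtain ⟨h1, h2, h3, h4⟩ := h
      refine ⟨Matrix.of fun i j => ⟨M.toBlocks₁₁ i j, M.toBlocks₂₁ i j⟩, ?_⟩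
      conv_rhs => rw [← fromBlocks_toBlocks M]
      rw [complexToRealMat_apply, fromBlocks_inj]
      refine ⟨rfl, h1.symm, rfl, ?_⟩
      rw [h3]; rfl
    intro h
    obtain ⟨A, hA⟩ := key X h
    have h' : ((X⁻¹ : GL (ι ⊕ ι) ℝ) : Matrix (ι ⊕ ι) (ι ⊕ ι) ℝ) * J ι ℝ =
        J ι ℝ * ((X⁻¹ : GL (ι ⊕ ι) ℝ) : Matrix (ι ⊕ ι) (ι ⊕ ι) ℝ) := by
      calc _ = ((X⁻¹ : GL (ι ⊕ ι) ℝ) : Matrix (ι ⊕ ι) (ι ⊕ ι) ℝ) *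
            (J ι ℝ * (X : Matrix (ι ⊕ ι) (ι ⊕ ι) ℝ)) *
            ((X⁻¹ : GL (ι ⊕ ι) ℝ) : Matrix (ι ⊕ ι) (ι ⊕ ι) ℝ) := by
            rw [Matrix.mul_assoc, Matrix.mul_assoc (J ι ℝ), X.mul_inv, Matrix.mul_one]
        _ = _ := by rw [← h, ← Matrix.mul_assoc, X.inv_mul, Matrix.one_mul]
    obtain ⟨B, hB⟩ := key _ h'
    refine ⟨⟨A, B, complexToRealMat_injective ?_, complexToRealMat_injective ?_⟩, ?_⟩
    · rw [map_mul, hA, hB, map_one, X.mul_inv]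
    · rw [map_mul, hA, hB, map_one, X.inv_mul]
    · ext1; exact hA

theorem quaternionToComplexMat_mul_J (A : Matrix ι ι (Quaternion ℝ)) :
    quaternionToComplexMat ι A * J ι ℂ = J ι ℂ * (quaternionToComplexMat ι A).map star := by
  simp only [quaternionToComplexMat_apply, J, fromBlocks_map, fromBlocks_multiply]
  congr 1 <;> ext <;> simp

/-- The antilinear map `z ↦ J z̄` squares to `-1`; the condition says that `X` commutes with this
quaternionic structure. -/
theorem mem_range_quaternionToComplex {X : GL (ι ⊕ ι) ℂ} :
    X ∈ (quaternionToComplex ι).range ↔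
      (X : Matrix (ι ⊕ ι) (ι ⊕ ι) ℂ) * J ι ℂ =
        J ι ℂ * (X : Matrix (ι ⊕ ι) (ι ⊕ ι) ℂ).map star := by
  constructor
  · rintro ⟨A, rfl⟩
    exact quaternionToComplexMat_mul_J _
  · have key : ∀ M : Matrix (ι ⊕ ι) (ι ⊕ ι) ℂ, M * J ι ℂ = J ι ℂ * M.map star →
        ∃ A, quaternionToComplexMat ι A = M := by
      intro M h
      rw [← fromBlocks_toBlocks M, J, fromBlocks_map, fromBlocks_multiply, fromBlocks_multiply,
        fromBlocks_inj] at h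
      simp only [Matrix.mul_zero, zero_add, Matrix.mul_one, Matrix.zero_mul, Matrix.one_mul,
        add_zero, Matrix.mul_neg, Matrix.neg_mul] at h
      obtain ⟨h1, h2, h3, h4⟩ := h
      refine ⟨Matrix.of fun i j => ⟨(M.toBlocks₁₁ i j).re, (M.toBlocks₁₁ i j).im,
        -(M.toBlocks₁₂ i j).re, -(M.toBlocks₁₂ i j).im⟩, ?_⟩
      conv_rhs => rw [← fromBlocks_toBlocks M]
      rw [quaternionToComplexMat_apply, fromBlocks_inj]
      refine ⟨rfl, ?_, ?_, ?_⟩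
      · ext i j
        exact Complex.ext (neg_neg _) (neg_neg _)
      · rw [neg_eq_iff_eq_neg] at h4
        ext i j
        have : M.toBlocks₂₁ i j = -star (M.toBlocks₁₂ i j) := congrFun (congrFun h4 i) j
        rw [this]
        rfl
      · ext i j
        have : M.toBlocks₂₂ i j = star (M.toBlocks₁₁ i j) := congrFun (congrFun h3 i) j
        rw [this]
        rfl
    intro h
    obtain ⟨A, hA⟩ := key X h
    have hc : (X : Matrix (ι ⊕ ι) (ι ⊕ ι) ℂ).map star *
        ((X⁻¹ : GL (ι ⊕ ι) ℂ) : Matrix (ι ⊕ ι) (ι ⊕ ι) ℂ).map star = 1 := by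
      have h1 : ∀ M N : Matrix (ι ⊕ ι) (ι ⊕ ι) ℂ, M.map star * N.map star = (M * N).map star :=
        fun M N => (Matrix.map_mul (f := starRingEnd ℂ)).symm
      rw [h1, X.mul_inv]
      ext i j
      simp [one_apply, apply_ite]
    have h' : ((X⁻¹ : GL (ι ⊕ ι) ℂ) : Matrix (ι ⊕ ι) (ι ⊕ ι) ℂ) * J ι ℂ =
        J ι ℂ * ((X⁻¹ : GL (ι ⊕ ι) ℂ) : Matrix (ι ⊕ ι) (ι ⊕ ι) ℂ).map star := by
      calc _ = ((X⁻¹ : GL (ι ⊕ ι) ℂ) : Matrix (ι ⊕ ι) (ι ⊕ ι) ℂ) *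
            (J ι ℂ * (X : Matrix (ι ⊕ ι) (ι ⊕ ι) ℂ).map star) *
            ((X⁻¹ : GL (ι ⊕ ι) ℂ) : Matrix (ι ⊕ ι) (ι ⊕ ι) ℂ).map star := by
            rw [Matrix.mul_assoc, Matrix.mul_assoc (J ι ℂ), hc, Matrix.mul_one]
        _ = _ := by rw [← h, ← Matrix.mul_assoc, X.inv_mul, Matrix.one_mul]
    obtain ⟨B, hB⟩ := key _ h'
    refine ⟨⟨A, B, quaternionToComplexMat_injective ?_, quaternionToComplexMat_injective ?_⟩, ?_⟩
    · rw [map_mul, hA, hB, map_one, X.mul_inv]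
    · rw [map_mul, hA, hB, map_one, X.inv_mul]
    · ext1; exact hA

theorem mem_range_quaternionToReal {X : GL ((ι ⊕ ι) ⊕ (ι ⊕ ι)) ℝ}
    (hI : (X : Matrix _ _ ℝ) * J (ι ⊕ ι) ℝ = J (ι ⊕ ι) ℝ * (X : Matrix _ _ ℝ))
    (hJ : (X : Matrix _ _ ℝ) * fromBlocks (J ι ℝ) 0 0 (-J ι ℝ) =
      fromBlocks (J ι ℝ) 0 0 (-J ι ℝ) * (X : Matrix _ _ ℝ)) :
    X ∈ (quaternionToReal ι).range := by
  obtain ⟨A, rfl⟩ := mem_range_complexToReal.mpr hI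
  have h0 : (J ι ℂ).map Complex.re = J ι ℝ := by
    ext (i | i) (j | j) <;> simp [J, one_apply, apply_ite]
  have h0' : (J ι ℂ).map Complex.im = 0 := by
    ext (i | i) (j | j) <;> simp [J, one_apply, apply_ite]
  -- `diag(J, -J)` is the real matrix of `z ↦ J z̄`, so `hJ` is commutation with the quaternionic
  -- structure.
  have h1 : fromBlocks (J ι ℝ) 0 0 (-J ι ℝ) =
      fromBlocks 1 0 0 (-1) * complexToRealMat (ι ⊕ ι) (J ι ℂ) := by
    simp [complexToRealMat_apply, h0, h0', fromBlocks_multiply]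
  have h2 : (fromBlocks 1 0 0 (-1) : Matrix ((ι ⊕ ι) ⊕ (ι ⊕ ι)) ((ι ⊕ ι) ⊕ (ι ⊕ ι)) ℝ) *
      fromBlocks 1 0 0 (-1) = 1 := by
    simp [fromBlocks_multiply]
  have h3 : (A : Matrix (ι ⊕ ι) (ι ⊕ ι) ℂ).map star * J ι ℂ = J ι ℂ * A := by
    apply complexToRealMat_injective
    rw [h1, coe_complexToReal, ← Matrix.mul_assoc, complexToRealMat_mul_conj] at hJ
    have := congrArg (fun M => fromBlocks 1 0 0 (-1) * M) hJ
    simpa only [← Matrix.mul_assoc, h2, Matrix.one_mul, ← map_mul] using this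
  have h4 : A ∈ (quaternionToComplex ι).range := by
    rw [mem_range_quaternionToComplex]
    have h5 : ∀ M N : Matrix (ι ⊕ ι) (ι ⊕ ι) ℂ, (M * N).map star = M.map star * N.map star :=
      fun M N => Matrix.map_mul (f := starRingEnd ℂ)
    have h6 : (J ι ℂ).map star = J ι ℂ := by
      ext (i | i) (j | j) <;> simp [J, one_apply, apply_ite]
    have := congrArg (fun M : Matrix (ι ⊕ ι) (ι ⊕ ι) ℂ => M.map star) h3
    simp only [h5, h6, Matrix.map_map] at this
    rwa [show (star ∘ star : ℂ → ℂ) = id by ext z; simp, Matrix.map_id] at this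
  obtain ⟨B, rfl⟩ := h4
  exact ⟨B, rfl⟩

end Embeddings

/-! ### Classical groups as intersections -/

section Intersections

variable {ι K : Type*} [Fintype ι] [DecidableEq ι]

theorem map_eq_inf_range {G H : Type*} [Group G] [Group H] {f : G →* H} {A : Subgroup G}
    {B : Subgroup H} (h : ∀ x, f x ∈ B ↔ x ∈ A) : A.map f = B ⊓ f.range := by
  have : A = B.comap f := by ext x; exact (h x).symm
  rw [this, Subgroup.map_comap_eq, inf_comm]

theorem transpose_mul_cancel [CommRing K] {X : GL ι K} {Φ M N : Matrix ι ι K} (hΦ : Φ * Φ = 1) :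
    (X : Matrix ι ι K)ᵀ * Φ * M = (X : Matrix ι ι K)ᵀ * Φ * N ↔ M = N := by
  refine ⟨fun h => ?_, fun h => by rw [h]⟩
  have h1 : ((X⁻¹ : GL ι K) : Matrix ι ι K)ᵀ * (X : Matrix ι ι K)ᵀ = 1 := by
    rw [← transpose_mul, X.mul_inv, transpose_one]
  have h2 : ∀ M : Matrix ι ι K,
      Φ * (((X⁻¹ : GL ι K) : Matrix ι ι K)ᵀ * ((X : Matrix ι ι K)ᵀ * Φ * M)) = M := by
    intro M
    rw [Matrix.mul_assoc (X : Matrix ι ι K)ᵀ, ← Matrix.mul_assoc _ _ (Φ * M), h1, Matrix.one_mul,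
      ← Matrix.mul_assoc, hΦ, Matrix.one_mul]
  rw [← h2 M, h, h2 N]

/-- If `Φ = Xᵀ * Φ * X`, then invariance of `Φ * J` reads `Xᵀ * Φ * (J * X) = Xᵀ * Φ * (X * J)`.
Cancelling the invertible `Xᵀ * Φ` leaves commutation with `J`. -/
theorem mem_bilinIsom_mul_J_iff {X : GL (ι ⊕ ι) ℝ} {Φ : Matrix (ι ⊕ ι) (ι ⊕ ι) ℝ}
    (hΦ : Φ * Φ = 1) (hX : X ∈ bilinIsom Φ) :
    X ∈ bilinIsom (Φ * J ι ℝ) ↔ X ∈ (complexToReal ι).range := by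
  rw [mem_bilinIsom] at hX
  rw [mem_range_complexToReal, mem_bilinIsom, ← Matrix.mul_assoc, Matrix.mul_assoc _ (J ι ℝ)]
  conv_lhs => rhs; rw [← hX, Matrix.mul_assoc _ _ (J ι ℝ)]
  rw [transpose_mul_cancel hΦ, eq_comm]

/-- The same cancellation, using the complex conjugate `Xᵀ Φ X̄ = Φ` of the Hermitian condition; it
leaves `J X = X̄ J`, the conjugate of the condition for being quaternionic. -/
theorem mem_bilinIsom_mul_J_iff_of_mem_sesqIsom {X : GL (ι ⊕ ι) ℂ}
    {Φ : Matrix (ι ⊕ ι) (ι ⊕ ι) ℂ} (hΦ : Φ * Φ = 1) (hΦ' : Φ.map star = Φ)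
    (hX : X ∈ sesqIsom Φ) :
    X ∈ bilinIsom (Φ * J ι ℂ) ↔ X ∈ (quaternionToComplex ι).range := by
  rw [mem_sesqIsom] at hX
  have h5 : ∀ M N : Matrix (ι ⊕ ι) (ι ⊕ ι) ℂ, (M * N).map star = M.map star * N.map star :=
    fun M N => Matrix.map_mul (f := starRingEnd ℂ)
  have hX' := congrArg (fun M : Matrix (ι ⊕ ι) (ι ⊕ ι) ℂ => M.map star) hX
  simp only [h5, hΦ', conjTranspose, Matrix.map_map] at hX'
  rw [show (star ∘ star : ℂ → ℂ) = id by ext z; simp, Matrix.map_id] at hX'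
  rw [mem_range_quaternionToComplex, mem_bilinIsom, ← Matrix.mul_assoc,
    Matrix.mul_assoc _ (J ι ℂ)]
  conv_lhs => rhs; rw [← hX', Matrix.mul_assoc _ _ (J ι ℂ)]
  rw [transpose_mul_cancel hΦ, eq_comm]
  have h6 : (J ι ℂ).map star = J ι ℂ := by
    ext (i | i) (j | j) <;> simp [J, one_apply, apply_ite]
  have h7 : ∀ M N : Matrix (ι ⊕ ι) (ι ⊕ ι) ℂ, M = N ↔ M.map star = N.map star := by
    intro M N
    refine ⟨fun h => by rw [h], fun h => ?_⟩
    ext i j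
    exact star_injective (congrFun (congrFun h i) j)
  rw [h7, h5, h5, h6, Matrix.map_map, show (star ∘ star : ℂ → ℂ) = id by ext z; simp,
    Matrix.map_id]

theorem signMat_mul_self (K : Type*) [Ring K] (r s : ℕ) : signMat K r s * signMat K r s = 1 := by
  simp [signMat, fromBlocks_multiply]

theorem map_complexToReal_OC (m : ℕ) :
    (OC m).map (complexToReal _) = O m m ⊓ (complexToReal (Fin m)).range := by
  refine map_eq_inf_range fun A => ?_
  rw [OC, ← complexToReal_mem_bilinIsom_conj, O, ← bilinIsom_neg, map_one, Matrix.mul_one]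
  simp [signMat, fromBlocks_neg]

theorem sympMat_map_re (m : ℕ) : (sympMat ℂ m).map Complex.re = sympMat ℝ m := by
  ext (i | i) (j | j) <;> simp [sympMat, one_apply, apply_ite]

theorem sympMat_map_im (m : ℕ) : (sympMat ℂ m).map Complex.im = 0 := by
  ext (i | i) (j | j) <;> simp [sympMat, one_apply, apply_ite]

theorem map_complexToReal_SpC (m : ℕ) : (SpC m).map (complexToReal _) =
    bilinIsom (fromBlocks (sympMat ℝ m) 0 0 (-sympMat ℝ m)) ⊓
      (complexToReal (Fin m ⊕ Fin m)).range := by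
  refine map_eq_inf_range fun A => ?_
  rw [SpC, ← complexToReal_mem_bilinIsom_conj, complexToRealMat_apply, sympMat_map_re,
    sympMat_map_im, fromBlocks_multiply]
  simp

theorem complexToRealMat_signMat (r s : ℕ) : complexToRealMat _ (signMat ℂ r s) =
    fromBlocks (signMat ℝ r s) 0 0 (signMat ℝ r s) := by
  have h1 : (signMat ℂ r s).map Complex.re = signMat ℝ r s := by
    ext (i | i) (j | j) <;> simp [signMat, one_apply, apply_ite]
  have h2 : (signMat ℂ r s).map Complex.im = 0 := by
    ext (i | i) (j | j) <;> simp [signMat, one_apply, apply_ite]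
  rw [complexToRealMat_apply, h1, h2, neg_zero]

theorem quaternionToComplexMat_signMat (r s : ℕ) :
    quaternionToComplexMat _ (signMat (Quaternion ℝ) r s) =
      fromBlocks (signMat ℂ r s) 0 0 (signMat ℂ r s) := by
  rw [quaternionToComplexMat_apply]
  congr 1 <;> ext (i | i) (j | j) <;>
    simp [signMat, one_apply, apply_ite, quatU_one, quatV_one]

/-- The form `i 1` becomes `diag(i, -i)`, a multiple of the Hermitian form of signature (m, m);
scaling does not change the isometry group, whence U(m, m). -/
theorem quaternionToComplexMat_quatI (m : ℕ) :
    quaternionToComplexMat (Fin m) (diagonal fun _ => quatI) = (-Complex.I) • signMat ℂ m m := by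
  have hU : quatU quatI = Complex.I := rfl
  have hV : quatV quatI = 0 := rfl
  rw [quaternionToComplexMat_apply, signMat, fromBlocks_smul]
  congr 1 <;> ext i j <;> by_cases h : i = j <;> simp [h, hU, hV]

theorem map_complexToReal_U_eq_inf_range (r s : ℕ) : (U r s).map (complexToReal _) =
    bilinIsom (fromBlocks (signMat ℝ r s) 0 0 (signMat ℝ r s)) ⊓ (complexToReal _).range :=
  map_eq_inf_range fun A => by
    rw [U, ← complexToReal_mem_bilinIsom, complexToRealMat_signMat]

theorem map_complexToReal_U (r s : ℕ) : (U r s).map (complexToReal _) =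
    bilinIsom (fromBlocks (signMat ℝ r s) 0 0 (signMat ℝ r s)) ⊓
      bilinIsom (fromBlocks 0 (signMat ℝ r s) (-signMat ℝ r s) 0) := by
  rw [map_complexToReal_U_eq_inf_range]
  ext X
  rw [Subgroup.mem_inf, Subgroup.mem_inf]
  refine and_congr_right fun hX => ?_
  rw [← mem_bilinIsom_mul_J_iff _ hX, ← bilinIsom_neg]
  · simp [J, fromBlocks_multiply, fromBlocks_neg]
  · simp [fromBlocks_multiply, signMat_mul_self]

theorem map_quaternionToComplex_SpH (r s : ℕ) : (SpH r s).map (quaternionToComplex _) =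
    sesqIsom (fromBlocks (signMat ℂ r s) 0 0 (signMat ℂ r s)) ⊓
      bilinIsom (fromBlocks 0 (-signMat ℂ r s) (signMat ℂ r s) 0) := by
  rw [map_eq_inf_range (B := sesqIsom (fromBlocks (signMat ℂ r s) 0 0 (signMat ℂ r s)))
    fun A => by rw [SpH, ← quaternionToComplex_mem_sesqIsom, quaternionToComplexMat_signMat]]
  ext X
  rw [Subgroup.mem_inf, Subgroup.mem_inf]
  refine and_congr_right fun hX => ?_
  rw [← mem_bilinIsom_mul_J_iff_of_mem_sesqIsom _ _ hX]
  · simp [J, fromBlocks_multiply]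
  · simp [fromBlocks_multiply, signMat_mul_self]
  · ext ((i | i) | (i | i)) ((j | j) | (j | j)) <;> simp [signMat, one_apply, apply_ite]

theorem map_quaternionToComplex_OStar (m : ℕ) : (OStar m).map (quaternionToComplex _) =
    U m m ⊓ bilinIsom (fromBlocks 0 1 1 0 : Matrix (Fin m ⊕ Fin m) (Fin m ⊕ Fin m) ℂ) := by
  rw [map_eq_inf_range (B := U m m) fun A => by
    rw [OStar, ← quaternionToComplex_mem_sesqIsom, quaternionToComplexMat_quatI,
      sesqIsom_smul (neg_ne_zero.mpr Complex.I_ne_zero), U]]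
  ext X
  rw [Subgroup.mem_inf, Subgroup.mem_inf]
  refine and_congr_right fun hX => ?_
  rw [← mem_bilinIsom_mul_J_iff_of_mem_sesqIsom (signMat_mul_self ℂ m m) _ hX]
  · simp [J, signMat, fromBlocks_multiply]
  · ext (i | i) (j | j) <;> simp [signMat, one_apply, apply_ite]

theorem map_quaternionToReal_eq {Φ : Matrix ι ι (Quaternion ℝ)} :
    (sesqIsom Φ).map (quaternionToReal ι) =
      bilinIsom (complexToRealMat _ (quaternionToComplexMat ι Φ)) ⊓ (quaternionToReal ι).range :=
  map_eq_inf_range fun A => by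
    rw [← quaternionToComplex_mem_sesqIsom, ← complexToReal_mem_bilinIsom]; rfl

theorem isConjTo_sympMat_two_mul (m : ℕ) :
    IsConjTo (bilinIsom (fromBlocks (sympMat ℝ m) 0 0 (-sympMat ℝ m))) (SpR (2 * m)) := by
  let f := finTwoMulEquiv m
  -- Swapping the two halves of the second copy turns `-J_m` into `J_m`, so a permutation suffices
  -- and the conjugating matrix is `1`.
  let e : Fin (2 * m) ⊕ Fin (2 * m) ≃ (Fin m ⊕ Fin m) ⊕ (Fin m ⊕ Fin m) :=
    ((Equiv.sumCongr f f).trans (Equiv.sumSumSumComm _ _ _ _)).trans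
      (Equiv.sumCongr (Equiv.refl _) (Equiv.sumComm _ _))
  refine isConjTo_bilinIsom e 1 ?_
  ext ((i | i) | (i | i)) ((j | j) | (j | j)) <;>
    simp [sympMat, e, one_apply]

theorem isConjTo_O_two_mul (r s : ℕ) :
    IsConjTo (bilinIsom (fromBlocks (signMat ℝ r s) 0 0 (signMat ℝ r s))) (O (2 * r) (2 * s)) := by
  let e : Fin (2 * r) ⊕ Fin (2 * s) ≃ (Fin r ⊕ Fin s) ⊕ (Fin r ⊕ Fin s) :=
    (Equiv.sumCongr (finTwoMulEquiv r) (finTwoMulEquiv s)).trans (Equiv.sumSumSumComm _ _ _ _)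
  refine isConjTo_bilinIsom e 1 ?_
  ext ((i | i) | (i | i)) ((j | j) | (j | j)) <;>
    simp [signMat, e, one_apply]

theorem isConjTo_U_two_mul (r s : ℕ) :
    IsConjTo (sesqIsom (fromBlocks (signMat ℂ r s) 0 0 (signMat ℂ r s))) (U (2 * r) (2 * s)) := by
  let e : Fin (2 * r) ⊕ Fin (2 * s) ≃ (Fin r ⊕ Fin s) ⊕ (Fin r ⊕ Fin s) :=
    (Equiv.sumCongr (finTwoMulEquiv r) (finTwoMulEquiv s)).trans (Equiv.sumSumSumComm _ _ _ _)
  have h : (fromBlocks (signMat ℂ r s) 0 0 (signMat ℂ r s)) =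
      (signMat ℂ (2 * r) (2 * s)).submatrix e.symm e.symm := by
    ext ((i | i) | (i | i)) ((j | j) | (j | j)) <;>
      simp [signMat, e, one_apply]
  refine isConjTo_sesqIsom e ?_
  rw [h]
  ext i j
  simp

theorem isConjTo_sympMat_add (K : Type*) [CommRing K] (r s : ℕ) :
    IsConjTo (bilinIsom (fromBlocks 0 (-signMat K r s) (signMat K r s) 0))
      (bilinIsom (sympMat K (r + s))) := by
  -- Multiplying one half of the basis by `I_{r,s}`, whose square is `1`, removes the signs.
  let P : Matrix ((Fin r ⊕ Fin s) ⊕ (Fin r ⊕ Fin s)) ((Fin r ⊕ Fin s) ⊕ (Fin r ⊕ Fin s)) K :=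
    fromBlocks (signMat K r s) 0 0 1
  have hP : P * P = 1 := by
    simp [P, fromBlocks_multiply, signMat_mul_self]
  refine isConjTo_bilinIsom (Equiv.sumCongr finSumFinEquiv.symm finSumFinEquiv.symm)
    ⟨P, P, hP, hP⟩ ?_
  have ht : (signMat K r s)ᵀ = signMat K r s := by
    simp [signMat, fromBlocks_transpose]
  simp only [P, fromBlocks_transpose, fromBlocks_multiply, ht]
  ext (i | i) (j | j) <;> simp [sympMat, signMat_mul_self, one_apply]

theorem isConjTo_OC_two_mul (m : ℕ) :
    IsConjTo (bilinIsom (fromBlocks 0 1 1 0 : Matrix (Fin m ⊕ Fin m) (Fin m ⊕ Fin m) ℂ))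
      (OC (2 * m)) := by
  -- In each hyperbolic plane the columns (1, 1/2) and (i, -i/2) are orthonormal for the form with
  -- matrix (0, 1; 1, 0). Hence the inverse `Q` is `Pᵀ` times that matrix.
  let P : Matrix (Fin m ⊕ Fin m) (Fin m ⊕ Fin m) ℂ :=
    fromBlocks 1 (Complex.I • 1) ((2⁻¹ : ℂ) • 1) ((-(2⁻¹ * Complex.I)) • 1)
  let Q : Matrix (Fin m ⊕ Fin m) (Fin m ⊕ Fin m) ℂ :=
    fromBlocks ((2⁻¹ : ℂ) • 1) 1 ((-(2⁻¹ * Complex.I)) • 1) (Complex.I • 1)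
  have hPQ : P * Q = 1 := by
    simp only [P, Q, fromBlocks_multiply]
    rw [← fromBlocks_one]
    congr 1 <;> ext i j <;> by_cases h : i = j <;> simp [h, smul_smul, one_apply]
    all_goals (ring_nf; simp only [Complex.I_sq]; norm_num)
  have hQP : Q * P = 1 := mul_eq_one_comm.mp hPQ
  refine isConjTo_bilinIsom (finTwoMulEquiv m) ⟨P, Q, hPQ, hQP⟩ ?_
  simp only [P, fromBlocks_multiply, fromBlocks_transpose]
  rw [submatrix_one_equiv, ← fromBlocks_one]
  congr 1 <;> ext i j <;> by_cases h : i = j <;> simp [h, smul_smul, one_apply]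
  all_goals (ring_nf; try (simp only [Complex.I_sq]; norm_num))

end Intersections

open Module

/-! ### Invariant bilinear forms -/

section InvariantForms

variable {G V : Type*} [Group G] [AddCommGroup V] [Module ℝ V] {ρ : Representation ℝ G V}

/-- Invariance of a bilinear form under a representation. -/
def IsInvForm (ρ : Representation ℝ G V) (b : LinearMap.BilinForm ℝ V) : Prop :=
  ∀ g x y, b (ρ g x) (ρ g y) = b x y

theorem eq_bot_or_eq_top_of_invariant (hρ : ρ.IsIrreducible) (W : Submodule ℝ V)
    (hW : ∀ g, ∀ x ∈ W, ρ g x ∈ W) : W = ⊥ ∨ W = ⊤ := by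
  let W' : Subrepresentation ρ := ⟨W, fun g x hx => hW g x hx⟩
  rcases hρ.eq_bot_or_eq_top W' with h | h
  · exact Or.inl (congrArg Subrepresentation.toSubmodule h)
  · exact Or.inr (congrArg Subrepresentation.toSubmodule h)

theorem nontrivial_of_isIrreducible (hρ : ρ.IsIrreducible) : Nontrivial V := by
  by_contra h
  rw [not_nontrivial_iff_subsingleton] at h
  have := hρ.toNontrivial
  obtain ⟨A, B, hAB⟩ := exists_pair_ne (Subrepresentation ρ)
  exact hAB (Subrepresentation.toSubmodule_injective (Subsingleton.elim _ _))

/-- The kernel of an invariant form is an invariant subspace, and it is not everything. -/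
theorem eq_zero_of_forall_apply_eq_zero (hρ : ρ.IsIrreducible) {b : LinearMap.BilinForm ℝ V}
    (hb : IsInvForm ρ b) (hb0 : b ≠ 0) (x : V) (hx : ∀ y, b x y = 0) : x = 0 := by
  rcases eq_bot_or_eq_top_of_invariant hρ (LinearMap.ker b) (fun g x hx => by
    rw [LinearMap.mem_ker] at hx ⊢
    ext y
    have := hb g x (ρ g⁻¹ y)
    rw [← Module.End.mul_apply, ← map_mul, mul_inv_cancel, map_one, Module.End.one_apply,
      hx] at this
    exact this) with h | h
  · have : x ∈ LinearMap.ker b := LinearMap.mem_ker.mpr (LinearMap.ext hx)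
    rwa [h, Submodule.mem_bot] at this
  · exact absurd (LinearMap.ker_eq_top.mp h) hb0

/-- An isomorphism onto the dual representation, read as a function of two vectors, is an invariant
form. -/
theorem exists_invForm_ne_zero (hρ : ρ.IsIrreducible) (hd : IsSelfDual ρ) :
    ∃ b : LinearMap.BilinForm ℝ V, IsInvForm ρ b ∧ b ≠ 0 := by
  obtain ⟨φ⟩ := hd
  have := nontrivial_of_isIrreducible hρ
  refine ⟨φ.toIntertwiningMap.toLinearMap, fun g x y => ?_, fun h => ?_⟩
  · change φ.toIntertwiningMap (ρ g x) (ρ g y) = φ.toIntertwiningMap x y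
    rw [Representation.IntertwiningMap.isIntertwining _ _ φ.toIntertwiningMap g x, Representation.dual_apply, Dual.transpose_apply,
      LinearMap.comp_apply, ← Module.End.mul_apply, ← map_mul, inv_mul_cancel, map_one,
      Module.End.one_apply]
  · obtain ⟨x, hx⟩ := exists_ne (0 : V)
    refine hx (φ.toLinearEquiv.injective ?_)
    rw [map_zero]
    exact LinearMap.congr_fun h x

theorem exists_isSymm_or_isSkew {b : LinearMap.BilinForm ℝ V} (hb0 : b ≠ 0) :
    ∃ c : ℝ, (c = 1 ∨ c = -1) ∧ b + c • b.flip ≠ 0 ∧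
      ∀ x y, (b + c • b.flip) x y = c * (b + c • b.flip) y x := by
  by_cases h : b + (1 : ℝ) • b.flip = 0
  · refine ⟨-1, Or.inr rfl, fun h' => hb0 ?_, fun x y => by simp⟩
    have : (2 : ℝ) • b = 0 := by
      rw [show (2 : ℝ) • b = (b + (1 : ℝ) • b.flip) + (b + (-1 : ℝ) • b.flip) by module, h, h',
        add_zero]
    simpa using this
  · exact ⟨1, Or.inl rfl, h, fun x y => by simp [add_comm]⟩

theorem IsInvForm.add_smul_flip {b : LinearMap.BilinForm ℝ V} (hb : IsInvForm ρ b) (c : ℝ) :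
    IsInvForm ρ (b + c • b.flip) := fun g x y => by
  change b _ _ + c * b _ _ = b x y + c * b y x
  rw [hb, hb]

end InvariantForms

/-! ### Invariant forms parametrized by the commutant -/

section Commutant

variable {G V D : Type*} [Group G] [AddCommGroup V] [Module ℝ V] {ρ : Representation ℝ G V}
  [DivisionRing D] [Algebra ℝ D] [Module D V] [IsScalarTower ℝ D V]

/-- The commutant of a representation acts on the space by scalars in `D`. -/
structure ActsAsCommutant (D : Type*) [DivisionRing D] [Module D V]
    (ρ : Representation ℝ G V) : Prop where
  comm : ∀ g (d : D) x, ρ g (d • x) = d • ρ g x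
  exists_smul : ∀ f : V →ₗ[ℝ] V, (∀ g x, f (ρ g x) = ρ g (f x)) → ∃ d : D, ∀ x, f x = d • x

/-- Scalar multiplication as a real linear map. -/
def smulMap (V : Type*) [AddCommGroup V] [Module ℝ V] [Module D V] [IsScalarTower ℝ D V] (d : D) :
    V →ₗ[ℝ] V where
  toFun x := d • x
  map_add' := smul_add d
  map_smul' r x := smul_algebra_smul_comm r d x

@[simp]
theorem smulMap_apply (d : D) (x : V) : smulMap V d x = d • x := rfl

/-- The bilinear forms `b (d • x) y`. -/
def twistForm (D : Type*) [DivisionRing D] [Algebra ℝ D] [Module D V] [IsScalarTower ℝ D V]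
    (b : LinearMap.BilinForm ℝ V) : D →ₗ[ℝ] LinearMap.BilinForm ℝ V where
  toFun d := b ∘ₗ smulMap V d
  map_add' d e := by ext; simp [add_smul]
  map_smul' r d := by ext; simp

@[simp]
theorem twistForm_apply (b : LinearMap.BilinForm ℝ V) (d : D) (x y : V) :
    twistForm D b d x y = b (d • x) y := rfl

theorem ActsAsCommutant.isInvForm_twistForm (h : ActsAsCommutant D ρ)
    {b : LinearMap.BilinForm ℝ V} (hb : IsInvForm ρ b) (d : D) : IsInvForm ρ (twistForm D b d) :=
  fun g x y => by rw [twistForm_apply, twistForm_apply, ← h.comm, hb]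

/-- A nondegenerate `b` identifies `V` with its dual; composing `b'` with the inverse identification
gives an endomorphism commuting with `G`, hence a scalar. -/
theorem ActsAsCommutant.exists_eq_twistForm [FiniteDimensional ℝ V] (h : ActsAsCommutant D ρ)
    {b : LinearMap.BilinForm ℝ V} (hb : IsInvForm ρ b)
    (hnd : ∀ x, (∀ y, b x y = 0) → x = 0) {b' : LinearMap.BilinForm ℝ V}
    (hb' : IsInvForm ρ b') : ∃ d : D, b' = twistForm D b d := by
  have hinj : Function.Injective b := by
    rw [← LinearMap.ker_eq_bot, LinearMap.ker_eq_bot']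
    exact fun x hx => hnd x fun y => LinearMap.congr_fun hx y
  let e : V ≃ₗ[ℝ] Dual ℝ V :=
    LinearEquiv.ofInjectiveOfFinrankEq b hinj Subspace.dual_finrank_eq.symm
  have he : ∀ x y, b (e.symm (b' x)) y = b' x y := fun x y =>
    LinearMap.congr_fun (e.apply_symm_apply (b' x)) y
  obtain ⟨d, hd⟩ := h.exists_smul (e.symm.toLinearMap ∘ₗ b') (fun g x => by
    refine hinj (LinearMap.ext fun y => ?_)
    obtain ⟨z, rfl⟩ : ∃ z, y = ρ g z := ⟨ρ g⁻¹ y, by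
      rw [← Module.End.mul_apply, ← map_mul, mul_inv_cancel, map_one, Module.End.one_apply]⟩
    simp only [LinearMap.comp_apply, LinearEquiv.coe_coe]
    rw [he, hb, he, hb'])
  refine ⟨d, LinearMap.ext fun x => LinearMap.ext fun y => ?_⟩
  rw [twistForm_apply, ← hd, LinearMap.comp_apply, LinearEquiv.coe_coe, he]

theorem twistForm_injective [Nontrivial V] {b : LinearMap.BilinForm ℝ V}
    (hnd : ∀ x, (∀ y, b x y = 0) → x = 0) : Function.Injective (twistForm D b) := by
  refine (injective_iff_map_eq_zero _).mpr fun d hd => ?_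
  obtain ⟨x, hx⟩ := exists_ne (0 : V)
  have := hnd (d • x) fun y => by rw [← twistForm_apply, hd]; rfl
  exact (smul_eq_zero.mp this).resolve_right hx

/-- Under `d ↦ b (d • x) y` the symmetry with sign `c` translates into the eigenvalue equation `σ d
= (c * ε) • d`. -/
theorem ActsAsCommutant.finrank_forms [FiniteDimensional ℝ V] [Nontrivial V]
    (h : ActsAsCommutant D ρ) {b : LinearMap.BilinForm ℝ V} (hb : IsInvForm ρ b)
    (hnd : ∀ x, (∀ y, b x y = 0) → x = 0) {σ : D → D}
    (hσ : ∀ d x y, b (d • x) y = b x (σ d • y)) {ε : ℝ} (hε : ∀ x y, b x y = ε * b y x)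
    {c : ℝ} {P : Submodule ℝ D} (hP : ∀ d, d ∈ P ↔ σ d = (c * ε) • d)
    {F : Submodule ℝ (LinearMap.BilinForm ℝ V)}
    (hF : ∀ b', b' ∈ F ↔ IsInvForm ρ b' ∧ ∀ x y, b' x y = c * b' y x) :
    finrank ℝ F = finrank ℝ P := by
  have hmem : ∀ d, twistForm D b d ∈ F ↔ d ∈ P := by
    intro d
    rw [hF, hP, and_iff_right (h.isInvForm_twistForm hb d)]
    simp only [twistForm_apply]
    constructor
    · intro h1
      rw [← sub_eq_zero]
      obtain ⟨x, hx⟩ := exists_ne (0 : V)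
      refine (smul_eq_zero.mp (hnd ((σ d - (c * ε) • d) • x) fun y => ?_)).resolve_right hx
      rw [hε, sub_smul, map_sub, ← hσ, h1, hε (d • x), smul_assoc, (b y).map_smul,
        smul_eq_mul]
      ring
    · intro h1 x y
      rw [hσ, h1, smul_assoc, (b x).map_smul, hε (d • y), smul_eq_mul]
      ring
  have : F = P.map (twistForm D b) := by
    ext b'
    rw [Submodule.mem_map]
    constructor
    · intro hb'
      obtain ⟨d, rfl⟩ := h.exists_eq_twistForm hb hnd ((hF b').mp hb').1
      exact ⟨d, (hmem d).mp hb', rfl⟩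
    · rintro ⟨d, hd, rfl⟩
      exact (hmem d).mpr hd
  rw [this]
  exact (Submodule.equivMapOfInjective _ (twistForm_injective hnd) P).finrank_eq.symm

theorem mem_symForms {b : LinearMap.BilinForm ℝ V} :
    b ∈ symForms ρ ↔ IsInvForm ρ b ∧ ∀ x y, b x y = 1 * b y x := by
  simp only [one_mul]; rfl

theorem mem_skewForms {b : LinearMap.BilinForm ℝ V} :
    b ∈ skewForms ρ ↔ IsInvForm ρ b ∧ ∀ x y, b x y = -1 * b y x := by
  simp only [neg_one_mul]; rfl

/-- Dimensions of the spaces of forms when the adjoint involution fixes the commutant. -/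
theorem ActsAsCommutant.finrank_forms_of_id [FiniteDimensional ℝ V] [Nontrivial V]
    (h : ActsAsCommutant D ρ) {b : LinearMap.BilinForm ℝ V} (hb : IsInvForm ρ b)
    (hnd : ∀ x, (∀ y, b x y = 0) → x = 0)
    (hσ : ∀ (d : D) x y, b (d • x) y = b x (d • y)) {ε : ℝ} (hε : ∀ x y, b x y = ε * b y x)
    {c : ℝ} {F F' : Submodule ℝ (LinearMap.BilinForm ℝ V)}
    (hF : ∀ b', b' ∈ F ↔ IsInvForm ρ b' ∧ ∀ x y, b' x y = c * b' y x)
    (hF' : ∀ b', b' ∈ F' ↔ IsInvForm ρ b' ∧ ∀ x y, b' x y = (-c) * b' y x)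
    (hc : c * ε = 1) :
    finrank ℝ F = finrank ℝ D ∧ finrank ℝ F' = 0 := by
  constructor
  · rw [h.finrank_forms (σ := id) hb hnd hσ hε (P := ⊤) (by simp [hc]) hF, finrank_top]
  · rw [h.finrank_forms (σ := id) hb hnd hσ hε (P := ⊥) (fun d => ?_) hF', finrank_bot]
    rw [neg_mul, hc, id, neg_one_smul, Submodule.mem_bot, eq_neg_iff_add_eq_zero,
      ← two_smul ℝ d, smul_eq_zero_iff_right two_ne_zero]

/-- Dimensions of the spaces of forms when the adjoint involution is a conjugation. -/
theorem ActsAsCommutant.finrank_forms_of_conj [FiniteDimensional ℝ V] [Nontrivial V]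
    [FiniteDimensional ℝ D]
    (h : ActsAsCommutant D ρ) {b : LinearMap.BilinForm ℝ V} (hb : IsInvForm ρ b)
    (hnd : ∀ x, (∀ y, b x y = 0) → x = 0) {σ : D → D}
    (hσ : ∀ d x y, b (d • x) y = b x (σ d • y)) {ε : ℝ} (hε : ∀ x y, b x y = ε * b y x)
    {re : D →ₗ[ℝ] ℝ} (hre : ∀ d, d + σ d = algebraMap ℝ D (2 * re d)) (hre1 : re 1 = 1)
    {c : ℝ} {F F' : Submodule ℝ (LinearMap.BilinForm ℝ V)}
    (hF : ∀ b', b' ∈ F ↔ IsInvForm ρ b' ∧ ∀ x y, b' x y = c * b' y x)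
    (hF' : ∀ b', b' ∈ F' ↔ IsInvForm ρ b' ∧ ∀ x y, b' x y = (-c) * b' y x)
    (hc : c * ε = 1) :
    finrank ℝ F = 1 ∧ finrank ℝ F' + 1 = finrank ℝ D := by
  -- From `σ d = 2 re d - d`, the eigenspace for `1` is the real line and the one for `-1` is the
  -- kernel of `re`.
  have hσ' : ∀ d, σ d = algebraMap ℝ D (2 * re d) - d := fun d => by rw [← hre]; abel
  constructor
  · rw [h.finrank_forms hb hnd hσ hε (P := Submodule.span ℝ {1}) (fun d => ?_) hF,
      finrank_span_singleton one_ne_zero]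
    rw [hc, one_smul, hσ', Submodule.mem_span_singleton, sub_eq_iff_eq_add, ← two_smul ℝ d,
      Algebra.algebraMap_eq_smul_one, mul_smul]
    constructor
    · rintro ⟨a, rfl⟩
      rw [map_smul, hre1, smul_eq_mul, mul_one]
    · intro hd
      exact ⟨re d, smul_right_injective D (two_ne_zero (α := ℝ)) hd⟩
  · rw [h.finrank_forms hb hnd hσ hε (P := LinearMap.ker re) (fun d => ?_) hF']
    · have := LinearMap.finrank_range_add_finrank_ker re
      rw [LinearMap.range_eq_top.mpr fun a => ⟨a • 1, by simp [hre1]⟩, finrank_top,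
        finrank_self] at this
      omega
    · rw [neg_mul, hc, neg_one_smul, hσ', LinearMap.mem_ker, sub_eq_neg_self,
        map_eq_zero_iff _ (algebraMap ℝ D).injective]
      simp

end Commutant

/-! ### Adapted real bases -/

section Bases

variable {ι V : Type*} [Fintype ι] [DecidableEq ι] [AddCommGroup V] [Module ℝ V]

/-- The base change matrix to `B` conjugates `κ` into `L`. The hypothesis quantifies over units `X`
because `LinearMap.toMatrix` gives a bare matrix; the unit itself is the conjugate of `κ g`. -/
theorem imageInConj_of_basis {G : Type*} [Group G] {n : ℕ} {κ : G →* GL (Fin n) ℝ}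
    {L : Subgroup (GL ι ℝ)} (B : Basis ι ℝ (Fin n → ℝ))
    (h : ∀ g, ∀ X : GL ι ℝ, (X : Matrix ι ι ℝ) = LinearMap.toMatrix B B (matRep κ g) → X ∈ L) :
    ImageInConj κ L := by
  have hcard : Fintype.card ι = Fintype.card (Fin n) := by
    rw [← finrank_eq_card_basis B, finrank_fintype_fun_eq_card]
  let e : ι ≃ Fin n := Fintype.equivOfCardEq hcard
  let B' := B.reindex e
  let S := Pi.basisFun ℝ (Fin n)
  let P : GL (Fin n) ℝ := ⟨S.toMatrix B', B'.toMatrix S, Basis.toMatrix_mul_toMatrix_flip _ _,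
    Basis.toMatrix_mul_toMatrix_flip _ _⟩
  refine ⟨_, ⟨e, P, rfl⟩, ?_⟩
  rintro _ ⟨g, rfl⟩
  rw [Subgroup.mem_map_equiv, mem_map_reindex]
  refine h g _ ?_
  have h1 : (κ g : Matrix (Fin n) (Fin n) ℝ) = LinearMap.toMatrix S S (matRep κ g) :=
    (LinearMap.toMatrix'_toLin' _).symm
  have h2 : B'.toMatrix S * (κ g : Matrix (Fin n) (Fin n) ℝ) * S.toMatrix B' =
      LinearMap.toMatrix B' B' (matRep κ g) := by
    rw [h1, basis_toMatrix_mul_linearMap_toMatrix_mul_basis_toMatrix]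
  have h3 : ((Units.map (reindexRingEquiv ℝ e.symm :
      Matrix (Fin n) (Fin n) ℝ →* Matrix ι ι ℝ) ((MulAut.conj P).symm (κ g)) : GL ι ℝ) :
      Matrix ι ι ℝ) =
      (B'.toMatrix S * (κ g : Matrix (Fin n) (Fin n) ℝ) * S.toMatrix B').submatrix e e := rfl
  rw [h3, h2]
  ext i j
  simp [B', LinearMap.toMatrix_apply]

theorem mem_bilinIsom_of_gram {b : LinearMap.BilinForm ℝ V} {f : V →ₗ[ℝ] V}
    (hf : ∀ x y, b (f x) (f y) = b x y) {B : Basis ι ℝ V} {X : GL ι ℝ}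
    (hX : (X : Matrix ι ι ℝ) = LinearMap.toMatrix B B f) {Φ : Matrix ι ι ℝ}
    (hΦ : ∀ i j, b (B i) (B j) = Φ i j) : X ∈ bilinIsom Φ := by
  have h1 : Φ = LinearMap.BilinForm.toMatrix B b := by
    ext i j
    rw [LinearMap.BilinForm.toMatrix_apply, hΦ]
  have h2 : b.comp f f = b := by ext x y; exact hf x y
  rw [mem_bilinIsom, hX, h1, ← LinearMap.BilinForm.toMatrix_comp, h2]

theorem commute_toMatrix {f t : V →ₗ[ℝ] V} (hft : ∀ x, f (t x) = t (f x)) {B : Basis ι ℝ V}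
    {T : Matrix ι ι ℝ} (hT : ∀ j, t (B j) = ∑ i, T i j • B i) :
    LinearMap.toMatrix B B f * T = T * LinearMap.toMatrix B B f := by
  have : T = LinearMap.toMatrix B B t := by
    ext i j
    rw [LinearMap.toMatrix_apply, hT]
    simp [Finsupp.single_apply]
  rw [this, ← LinearMap.toMatrix_comp, ← LinearMap.toMatrix_comp]
  congr 1
  ext x
  exact hft x

variable {κ : Type*}

section Complex

variable [Module ℂ V] [IsScalarTower ℝ ℂ V]

/-- The real basis `v, i v` underlying a complex basis `v`. -/
noncomputable def complexRealBasis (B : Basis κ ℂ V) : Basis (κ ⊕ κ) ℝ V :=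
  (Complex.basisOneI.smulTower B).reindex
    ((Equiv.prodCongr finTwoEquiv (Equiv.refl κ)).trans (Equiv.boolProdEquivSum κ))

@[simp]
theorem complexRealBasis_inl (B : Basis κ ℂ V) (a : κ) : complexRealBasis B (.inl a) = B a := by
  have : finTwoEquiv.symm false = 0 := rfl
  simp [complexRealBasis, this]

@[simp]
theorem complexRealBasis_inr (B : Basis κ ℂ V) (a : κ) :
    complexRealBasis B (.inr a) = Complex.I • B a := by
  have : finTwoEquiv.symm true = 1 := rfl
  simp [complexRealBasis, this]

theorem mem_range_complexToReal_of_basis [Fintype κ] [DecidableEq κ] (B : Basis κ ℂ V) {f : V →ₗ[ℝ] V}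
    (hf : ∀ (d : ℂ) x, f (d • x) = d • f x) {X : GL (κ ⊕ κ) ℝ}
    (hX : (X : Matrix (κ ⊕ κ) (κ ⊕ κ) ℝ) =
      LinearMap.toMatrix (complexRealBasis B) (complexRealBasis B) f) :
    X ∈ (complexToReal κ).range := by
  rw [mem_range_complexToReal, hX]
  refine commute_toMatrix (t := smulMap V Complex.I) (fun x => hf _ _) ?_
  rintro (j | j) <;> simp [J, Matrix.one_apply, ite_smul, smul_smul]

end Complex

section Quaternionic

variable [Module (Quaternion ℝ) V] [IsScalarTower ℝ (Quaternion ℝ) V]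

/-- The unit `j`. -/
def quatJ : Quaternion ℝ := ⟨0, 0, 1, 0⟩

/-- The unit `k`. -/
def quatK : Quaternion ℝ := ⟨0, 0, 0, 1⟩

@[simp] theorem quatI_re : quatI.re = 0 := rfl
@[simp] theorem quatI_imI : quatI.imI = 1 := rfl
@[simp] theorem quatI_imJ : quatI.imJ = 0 := rfl
@[simp] theorem quatI_imK : quatI.imK = 0 := rfl
@[simp] theorem quatJ_re : quatJ.re = 0 := rfl
@[simp] theorem quatJ_imI : quatJ.imI = 0 := rfl
@[simp] theorem quatJ_imJ : quatJ.imJ = 1 := rfl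
@[simp] theorem quatJ_imK : quatJ.imK = 0 := rfl
@[simp] theorem quatK_re : quatK.re = 0 := rfl
@[simp] theorem quatK_imI : quatK.imI = 0 := rfl
@[simp] theorem quatK_imJ : quatK.imJ = 0 := rfl
@[simp] theorem quatK_imK : quatK.imK = 1 := rfl

/-- The basis `1, i, j, k`. -/
noncomputable def quatBasis : Basis (Fin 4) ℝ (Quaternion ℝ) :=
  QuaternionAlgebra.basisOneIJK (-1) 0 (-1)

theorem quatBasis_apply (i : Fin 4) : quatBasis i = ![1, quatI, quatJ, quatK] i := by
  apply quatBasis.repr.injective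
  rw [Basis.repr_self]
  ext j
  have h : ∀ q : Quaternion ℝ, quatBasis.repr q j = ![q.re, q.imI, q.imJ, q.imK] j :=
    fun q => congrFun (QuaternionAlgebra.coe_basisOneIJK_repr (-1) 0 (-1) q) j
  rw [h]
  fin_cases i <;> fin_cases j <;> simp <;> rfl

/-- Four copies of a type, in the order matching the units `1, i, j, k`. -/
def finFourProdEquiv (κ : Type*) : Fin 4 × κ ≃ (κ ⊕ κ) ⊕ (κ ⊕ κ) where
  toFun p := ![.inl (.inl p.2), .inr (.inl p.2), .inl (.inr p.2), .inr (.inr p.2)] p.1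
  invFun := Sum.elim (Sum.elim (fun a => (0, a)) fun a => (2, a))
    (Sum.elim (fun a => (1, a)) fun a => (3, a))
  left_inv := by
    rintro ⟨i, a⟩
    fin_cases i <;> rfl
  right_inv := by
    rintro ((a | a) | (a | a)) <;> rfl

/-- The real basis `v, j v, i v, k v` underlying a quaternionic basis `v`. -/
noncomputable def quaternionRealBasis (B : Basis κ (Quaternion ℝ) V) :
    Basis ((κ ⊕ κ) ⊕ (κ ⊕ κ)) ℝ V :=
  (quatBasis.smulTower B).reindex (finFourProdEquiv κ)

theorem quaternionRealBasis_apply (B : Basis κ (Quaternion ℝ) V) (a : κ) :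
    quaternionRealBasis B (.inl (.inl a)) = B a ∧
    quaternionRealBasis B (.inl (.inr a)) = quatJ • B a ∧
    quaternionRealBasis B (.inr (.inl a)) = quatI • B a ∧
    quaternionRealBasis B (.inr (.inr a)) = quatK • B a := by
  have h : ∀ i, quaternionRealBasis B (finFourProdEquiv κ (i, a)) =
      (![1, quatI, quatJ, quatK] i : Quaternion ℝ) • B a := fun i => by
    rw [quaternionRealBasis, Basis.reindex_apply, Equiv.symm_apply_apply, Basis.smulTower_apply,
      quatBasis_apply]
  exact ⟨(h 0).trans (one_smul _ _), h 2, h 1, h 3⟩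

theorem quat_mul_table :
    quatI * quatI = -1 ∧ quatI * quatJ = quatK ∧ quatI * quatK = -quatJ ∧
    quatJ * quatI = -quatK ∧ quatJ * quatJ = -1 ∧ quatJ * quatK = quatI ∧
    quatK * quatI = quatJ ∧ quatK * quatJ = -quatI ∧ quatK * quatK = -1 := by
  refine ⟨?_, ?_, ?_, ?_, ?_, ?_, ?_, ?_, ?_⟩ <;> ext <;> simp <;> rfl

/-- In the order `v, jv, iv, kv` multiplication by `i` has matrix `J` and multiplication by `j` has
matrix `diag(J, -J)`; the sign comes from `j i = -k`. -/
theorem mem_range_quaternionToReal_of_basis [Fintype κ] [DecidableEq κ]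
    (B : Basis κ (Quaternion ℝ) V) {f : V →ₗ[ℝ] V}
    (hf : ∀ (d : Quaternion ℝ) x, f (d • x) = d • f x) {X : GL ((κ ⊕ κ) ⊕ (κ ⊕ κ)) ℝ}
    (hX : (X : Matrix ((κ ⊕ κ) ⊕ (κ ⊕ κ)) ((κ ⊕ κ) ⊕ (κ ⊕ κ)) ℝ) =
      LinearMap.toMatrix (quaternionRealBasis B) (quaternionRealBasis B) f) :
    X ∈ (quaternionToReal κ).range := by
  obtain ⟨h1, h2, h3, h4, h5, h6, h7, h8, h9⟩ := quat_mul_table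
  apply mem_range_quaternionToReal
  · rw [hX]
    refine commute_toMatrix (t := smulMap V quatI) (fun x => hf _ _) ?_
    rintro ((j | j) | (j | j)) <;>
      simp [J, Matrix.one_apply, ite_smul, smul_smul, quaternionRealBasis_apply, h1, h2, h3]
  · rw [hX]
    refine commute_toMatrix (t := smulMap V quatJ) (fun x => hf _ _) ?_
    rintro ((j | j) | (j | j)) <;>
      simp [J, Matrix.one_apply, ite_smul, smul_smul, quaternionRealBasis_apply, h4, h5, h6]

end Quaternionic

end Bases

/-! ### Diagonalization of Hermitian forms -/

section HermitianBasis

variable {D V : Type*} [DivisionRing D] [Algebra ℝ D] [AddCommGroup V] [Module ℝ V] [Module D V]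
  [IsScalarTower ℝ D V] [FiniteDimensional ℝ D] [FiniteDimensional ℝ V]

/-- Hermitian forms have orthogonal bases of vectors of length `±1`. -/
theorem exists_hermitian_basis {b : LinearMap.BilinForm ℝ V} {σ : D → D}
    (hσ : ∀ d x y, b (d • x) y = b x (σ d • y)) (hε : ∀ x y, b x y = b y x)
    (hnd : ∀ x, (∀ y, b x y = 0) → x = 0) {re : D →ₗ[ℝ] ℝ}
    (hre : ∀ d, d + σ d = algebraMap ℝ D (2 * re d)) (hre1 : re 1 = 1) :
    ∃ (r s : ℕ) (B : Basis (Fin r ⊕ Fin s) D V),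
      ∀ i j (d : D), b (B i) (d • B j) = signMat ℝ r s i j * re d := by
  -- By symmetry `d` and `σ d` contribute equally, and their sum is the real scalar `2 re d`. So the
  -- functional of `v` is a real multiple of `re`, normalized by `1 / √|b v v|` up to sign.
  have hv : ∀ v (d : D), b v (d • v) = re d * b v v := by
    intro v d
    have h1 : b v (σ d • v) = b v (d • v) := by rw [← hσ, hε]
    have h2 : b v ((d + σ d) • v) = 2 * re d * b v v := by
      rw [hre, algebraMap_smul, map_smul, smul_eq_mul]
    rw [add_smul, map_add, h1] at h2
    linarith
  obtain ⟨r, s, B, h1, h2, h3⟩ := exists_orthogonal_basis_sign (ε := 1) hσ (by simpa using hε) hnd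
    ⟨1, by
      rw [one_smul, hre, hre1, mul_one]
      exact (map_ne_zero_iff _ (algebraMap ℝ D).injective).mpr two_ne_zero⟩
    (f := re) (fun u hu => by
      by_contra h
      have := hu u⁻¹
      rw [inv_mul_cancel₀ h, hre1] at this
      exact one_ne_zero this)
    (fun v ⟨d, hd⟩ => by
      rw [hv] at hd
      have h0 : b v v ≠ 0 := right_ne_zero_of_mul hd
      have hpos : 0 < |b v v| := abs_pos.mpr h0
      set r := (√|b v v|)⁻¹ with hr
      have hrr : r * r * |b v v| = 1 := by
        rw [hr, ← mul_inv, Real.mul_self_sqrt hpos.le, inv_mul_cancel₀ hpos.ne']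
      refine ⟨algebraMap ℝ D r, ?_⟩
      have h4 : ∀ d : D, b (algebraMap ℝ D r • v) (d • algebraMap ℝ D r • v) =
          re d * (r * r * b v v) := by
        intro d
        rw [hv, algebraMap_smul]
        simp only [map_smul, LinearMap.smul_apply, smul_eq_mul]
        ring
      simp only [h4]
      rcases abs_choice (b v v) with h | h
      · left; intro d; rw [h] at hrr; rw [hrr, mul_one]
      · right; intro d
        rw [h] at hrr
        rw [show r * r * b v v = -1 by linarith, mul_neg_one])
  refine ⟨r, s, B, ?_⟩
  rintro (i | i) (j | j) d
  · by_cases h : i = j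
    · subst h; simp [h1, signMat]
    · rw [h3 _ _ (fun h' => h (Sum.inl_injective h'))]; simp [signMat, h]
  · rw [h3 _ _ (by simp)]; simp [signMat]
  · rw [h3 _ _ (by simp)]; simp [signMat]
  · by_cases h : i = j
    · subst h; simp [h2, signMat]
    · rw [h3 _ _ (fun h' => h (Sum.inr_injective h'))]; simp [signMat, h]

end HermitianBasis

/-! ### Commutant ℝ: O(p, q) and Sp(m, ℝ) -/

section RealType

variable {G : Type*} [Group G] {n : ℕ} {κ : G →* GL (Fin n) ℝ}
  {b : LinearMap.BilinForm ℝ (Fin n → ℝ)}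

theorem imageInConj_O (hb : IsInvForm (matRep κ) b) (hε : ∀ x y, b x y = b y x)
    (hnd : ∀ x, (∀ y, b x y = 0) → x = 0) : ∃ p q : ℕ, p + q = n ∧ ImageInConj κ (O p q) := by
  obtain ⟨p, q, B, hB⟩ := exists_hermitian_basis (D := ℝ) (σ := id) (b := b) (by simp) hε hnd
    (re := LinearMap.id) (fun d => by simp; ring) rfl
  refine ⟨p, q, ?_, imageInConj_of_basis B fun g X hX => ?_⟩
  · have := finrank_eq_card_basis B
    rw [finrank_fintype_fun_eq_card] at this
    simpa using this.symm
  · refine mem_bilinIsom_of_gram (hb g) hX fun i j => ?_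
    simpa using hB i j 1

theorem imageInConj_SpR (hb : IsInvForm (matRep κ) b) (hε : ∀ x y, b x y = -b y x)
    (hnd : ∀ x, (∀ y, b x y = 0) → x = 0) : ∃ m : ℕ, 2 * m = n ∧ ImageInConj κ (SpR m) := by
  -- The functional `-id` matches the entry `-1` in the upper right block of `sympMat`.
  obtain ⟨m, B, h1, h2, h3⟩ := exists_symplectic_basis (D := ℝ) (b := b) (by simp) hε hnd
    (-LinearMap.id) (by
      intro h
      simpa using LinearMap.congr_fun h 1)
  refine ⟨m, ?_, imageInConj_of_basis B fun g X hX => ?_⟩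
  · have := finrank_eq_card_basis B
    rw [finrank_fintype_fun_eq_card] at this
    simp only [Fintype.card_fin, Fintype.card_sum] at this
    omega
  · refine mem_bilinIsom_of_gram (hb g) hX ?_
    rintro (i | i) (j | j)
    · simpa [sympMat] using h1 i j 1
    · simpa [sympMat, one_apply, apply_ite] using h3 i j 1
    · have := h3 j i 1
      rw [one_smul] at this
      rw [hε, this]
      by_cases h : j = i
      · simp [sympMat, h]
      · simp [sympMat, h, one_apply, Ne.symm h]
    · simpa [sympMat] using h2 i j 1

end RealType

/-! ### Commutant ℂ: U(r, s), O(m, ℂ) and Sp(m, ℂ) -/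

section ComplexType

variable {G : Type*} [Group G] {n : ℕ} {κ : G →* GL (Fin n) ℝ}
  {b : LinearMap.BilinForm ℝ (Fin n → ℝ)} [Module ℂ (Fin n → ℝ)]
  [IsScalarTower ℝ ℂ (Fin n → ℝ)]

theorem card_of_complexBasis {ι : Type*} [Fintype ι] (B : Basis ι ℂ (Fin n → ℝ)) :
    2 * Fintype.card ι = n := by
  have := finrank_eq_card_basis (complexRealBasis B)
  rw [finrank_fintype_fun_eq_card] at this
  simp only [Fintype.card_fin, Fintype.card_sum] at this
  omega

theorem imageInConj_U (hκ : ActsAsCommutant ℂ (matRep κ)) (hb : IsInvForm (matRep κ) b)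
    (hσ : ∀ (d : ℂ) x y, b (d • x) y = b x (star d • y)) (hε : ∀ x y, b x y = b y x)
    (hnd : ∀ x, (∀ y, b x y = 0) → x = 0) : ∃ r s : ℕ, 2 * r + 2 * s = n ∧
      ImageInConj κ ((U r s).map (complexToReal _)) := by
  obtain ⟨r, s, B, hB⟩ := exists_hermitian_basis hσ hε hnd (re := Complex.reLm)
    (fun d => by apply Complex.ext <;> simp; ring) (by simp)
  refine ⟨r, s, ?_, imageInConj_of_basis (complexRealBasis B) fun g X hX => ?_⟩
  · have := card_of_complexBasis B
    simp only [Fintype.card_fin, Fintype.card_sum] at this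
    omega
  · rw [map_complexToReal_U_eq_inf_range]
    refine ⟨mem_bilinIsom_of_gram (hb g) hX ?_, mem_range_complexToReal_of_basis B (hκ.comm g) hX⟩
    rintro (i | i) (j | j)
    · simpa using hB i j 1
    · simpa using hB i j Complex.I
    · simpa [hσ] using hB i j (-Complex.I)
    · simpa [hσ, smul_smul] using hB i j 1

theorem imageInConj_OC (hρ : (matRep κ).IsIrreducible) (hκ : ActsAsCommutant ℂ (matRep κ))
    (hb : IsInvForm (matRep κ) b)
    (hσ : ∀ (d : ℂ) x y, b (d • x) y = b x (d • y)) (hε : ∀ x y, b x y = b y x)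
    (hnd : ∀ x, (∀ y, b x y = 0) → x = 0) : 4 ≤ n ∧ ∃ m : ℕ, 2 * m = n ∧
      ImageInConj κ ((OC m).map (complexToReal _)) := by
  -- With the functional `-re`, the vectors `B i` have length `-1` and the vectors `i B i` length
  -- `+1`, in the order of the blocks of `signMat`.
  obtain ⟨m, B, hB, horth⟩ := exists_orthogonal_basis_fin (D := ℂ) (σ := id) (ε := 1) hσ
    (by simpa using hε) hnd ⟨1, by norm_num⟩ (f := fun d => -d.re)
    (fun u hu => by
      by_contra h
      have := hu u⁻¹
      simp [h] at this)
    (fun v ⟨d, hd⟩ => by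
      have hd' : ∀ d : ℂ, b v (d • v) = (d * ⟨b v v, -b v (Complex.I • v)⟩).re := by
        intro d
        have : d • v = d.re • v + d.im • Complex.I • v := by
          have hc : ∀ (r : ℝ) (x : Fin n → ℝ), (r : ℂ) • x = r • x :=
            fun r x => algebraMap_smul ℂ r x
          rw [← hc, ← hc, smul_smul, ← add_smul, Complex.re_add_im]
        rw [this, map_add, map_smul, map_smul, smul_eq_mul, smul_eq_mul, Complex.mul_re]
        simp
      -- The value at `v` of the complex bilinear form with real part `b`. It is rescaled to `-1` by
      -- a square root of `-w⁻¹`.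
      set w : ℂ := ⟨b v v, -b v (Complex.I • v)⟩
      have hw : w ≠ 0 := by
        rintro hw
        rw [hd', hw] at hd
        simp at hd
      obtain ⟨e, he⟩ := IsAlgClosed.exists_pow_nat_eq (-w⁻¹) (n := 2) two_pos
      refine ⟨e, fun d => ?_⟩
      rw [hσ, smul_smul, smul_smul, hd',
        show e * d * e * w = e ^ 2 * w * d by ring, he, neg_mul, inv_mul_cancel₀ hw]
      simp)
  have hB' : ∀ i j (d : ℂ), b (B i) (d • B j) = if i = j then -d.re else 0 := by
    intro i j d
    split_ifs with h
    · rw [h, hB]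
    · exact horth i j h d
  have hm : 2 * m = n := by simpa using card_of_complexBasis B
  have := nontrivial_of_isIrreducible hρ
  refine ⟨?_, m, hm, imageInConj_of_basis (complexRealBasis B) fun g X hX => ?_⟩
  · by_contra hn
    obtain rfl | rfl : m = 0 ∨ m = 1 := by omega
    · subst hm
      exact not_subsingleton (Fin 0 → ℝ) inferInstance
    · set v := B 0 with hv
      have hv0 : v ≠ 0 := B.ne_zero 0
      -- In complex dimension one, `g` acts on `v` by a scalar `d` with `Re (d x d) = Re x` for all
      -- `x`, so `d = ±1`. The real line through `v` is then invariant in a real plane.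
      have hg : ∀ g, ∃ c : ℝ, matRep κ g v = c • v := by
        intro g
        obtain ⟨d, hd⟩ : ∃ d : ℂ, matRep κ g v = d • v :=
          ⟨B.repr (matRep κ g v) 0, by simpa using (B.sum_repr (matRep κ g v)).symm⟩
        have h1 : ∀ x : ℂ, (d * x * d).re = x.re := by
          intro x
          have := hb g v (x • v)
          rw [hκ.comm, hd, hσ, smul_smul, smul_smul, hB', hB', if_pos rfl, if_pos rfl,
            neg_inj] at this
          exact this
        have h2 : d * d = 1 := by
          have h3 := h1 1
          have h4 := h1 Complex.I
          apply Complex.ext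
          · simpa using h3
          · simp at h4 ⊢
            linarith
        rcases mul_self_eq_one_iff.mp h2 with h | h
        · exact ⟨1, by rw [hd, h, one_smul, one_smul]⟩
        · exact ⟨-1, by rw [hd, h, neg_one_smul, neg_one_smul]⟩
      rcases eq_bot_or_eq_top_of_invariant hρ (Submodule.span ℝ {v}) (fun g x hx => by
        obtain ⟨a, rfl⟩ := Submodule.mem_span_singleton.mp hx
        obtain ⟨c, hc⟩ := hg g
        rw [map_smul, hc]
        exact Submodule.smul_mem _ _ (Submodule.smul_mem _ _
          (Submodule.mem_span_singleton_self v))) with h | h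
      · exact hv0 (Submodule.span_singleton_eq_bot.mp h)
      · have h1 := finrank_span_singleton (K := ℝ) hv0
        rw [h, finrank_top, finrank_fintype_fun_eq_card, Fintype.card_fin] at h1
        omega
  · rw [map_complexToReal_OC]
    refine ⟨mem_bilinIsom_of_gram (hb g) hX ?_, mem_range_complexToReal_of_basis B (hκ.comm g) hX⟩
    rintro (i | i) (j | j)
    · have := hB' i j 1
      rw [one_smul] at this
      by_cases h : i = j
      · subst h
        simpa [signMat] using this
      · simp [signMat, this, h]
    · simpa [signMat] using hB' i j Complex.I
    · simpa [signMat, hσ] using hB' i j Complex.I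
    · have := hB' i j (Complex.I * Complex.I)
      simp only [complexRealBasis_inr, hσ, smul_smul, this]
      by_cases h : i = j <;> simp [signMat, h]

theorem imageInConj_SpC (hκ : ActsAsCommutant ℂ (matRep κ)) (hb : IsInvForm (matRep κ) b)
    (hσ : ∀ (d : ℂ) x y, b (d • x) y = b x (d • y)) (hε : ∀ x y, b x y = -b y x)
    (hnd : ∀ x, (∀ y, b x y = 0) → x = 0) : ∃ m : ℕ, 4 * m = n ∧
      ImageInConj κ ((SpC m).map (complexToReal _)) := by
  obtain ⟨m, B, h1, h2, h3⟩ := exists_symplectic_basis (D := ℂ) (b := b) hσ hε hnd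
    (-Complex.reLm) (by
      intro h
      simpa using LinearMap.congr_fun h 1)
  refine ⟨m, ?_, imageInConj_of_basis (complexRealBasis B) fun g X hX => ?_⟩
  · have := card_of_complexBasis B
    simp only [Fintype.card_fin, Fintype.card_sum] at this
    omega
  · have hB : ∀ i j (d : ℂ), b (B i) (d • B j) = sympMat ℝ m i j * d.re := by
      rintro (i | i) (j | j) d
      · simpa [sympMat] using h1 i j d
      · rw [h3]
        by_cases h : i = j <;> simp [sympMat, h]
      · rw [hε, hσ, h3]
        by_cases h : j = i
        · simp [sympMat, h]
        · simp [sympMat, h, one_apply, Ne.symm h]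
      · simpa [sympMat] using h2 i j d
    rw [map_complexToReal_SpC]
    refine ⟨mem_bilinIsom_of_gram (hb g) hX ?_, mem_range_complexToReal_of_basis B (hκ.comm g) hX⟩
    rintro (i | i) (j | j)
    · simpa using hB i j 1
    · simpa using hB i j Complex.I
    · simpa [hσ] using hB i j Complex.I
    · have := hB i j (Complex.I * Complex.I)
      simp only [complexRealBasis_inr, hσ, smul_smul, this]
      simp

end ComplexType

/-! ### Commutant ℍ: Sp(r, s) and O*(m) -/

section QuaternionicType

variable {G : Type*} [Group G] {n : ℕ} {κ : G →* GL (Fin n) ℝ}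
  {b : LinearMap.BilinForm ℝ (Fin n → ℝ)} [Module (Quaternion ℝ) (Fin n → ℝ)]
  [IsScalarTower ℝ (Quaternion ℝ) (Fin n → ℝ)]

theorem card_of_quaternionBasis {ι : Type*} [Fintype ι] (B : Basis ι (Quaternion ℝ) (Fin n → ℝ)) :
    4 * Fintype.card ι = n := by
  have := finrank_eq_card_basis (quaternionRealBasis B)
  rw [finrank_fintype_fun_eq_card] at this
  simp only [Fintype.card_fin, Fintype.card_sum] at this
  omega

/-- The real part of a quaternion as a linear functional. -/
def quatRe : Quaternion ℝ →ₗ[ℝ] ℝ where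
  toFun q := q.re
  map_add' _ _ := rfl
  map_smul' _ _ := rfl

@[simp]
theorem quatRe_apply (q : Quaternion ℝ) : quatRe q = q.re := rfl

@[simp] theorem quat_one_re : (1 : Quaternion ℝ).re = 1 := rfl
@[simp] theorem quat_one_imI : (1 : Quaternion ℝ).imI = 0 := rfl
@[simp] theorem quat_one_imJ : (1 : Quaternion ℝ).imJ = 0 := rfl
@[simp] theorem quat_one_imK : (1 : Quaternion ℝ).imK = 0 := rfl

theorem quat_add_star (q : Quaternion ℝ) :
    q + star q = algebraMap ℝ (Quaternion ℝ) (2 * quatRe q) := by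
  rw [Quaternion.self_add_star', quatRe_apply]; rfl

theorem star_quat_units : star quatI = -quatI ∧ star quatJ = -quatJ ∧ star quatK = -quatK := by
  refine ⟨?_, ?_, ?_⟩ <;> ext <;> simp

theorem imageInConj_SpH (hκ : ActsAsCommutant (Quaternion ℝ) (matRep κ))
    (hb : IsInvForm (matRep κ) b)
    (hσ : ∀ (d : Quaternion ℝ) x y, b (d • x) y = b x (star d • y)) (hε : ∀ x y, b x y = b y x)
    (hnd : ∀ x, (∀ y, b x y = 0) → x = 0) : ∃ r s : ℕ, 4 * r + 4 * s = n ∧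
      ImageInConj κ ((SpH r s).map (quaternionToReal _)) := by
  obtain ⟨r, s, B, hB⟩ := exists_hermitian_basis hσ hε hnd (re := quatRe) quat_add_star (by simp)
  refine ⟨r, s, ?_, imageInConj_of_basis (quaternionRealBasis B) fun g X hX => ?_⟩
  · have := card_of_quaternionBasis B
    simp only [Fintype.card_fin, Fintype.card_sum] at this
    omega
  · obtain ⟨t1, t2, t3, t4, t5, t6, t7, t8, t9⟩ := quat_mul_table
    obtain ⟨s1, s2, s3⟩ := star_quat_units
    rw [SpH, map_quaternionToReal_eq, quaternionToComplexMat_signMat]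
    refine ⟨mem_bilinIsom_of_gram (hb g) hX ?_,
      mem_range_quaternionToReal_of_basis B (hκ.comm g) hX⟩
    have h1 := hB
    have h0 : ∀ i j, b (B i) (B j) = signMat ℝ r s i j := fun i j => by simpa using hB i j 1
    have h2 := congrArg (fun M => Matrix.toBlocks₁₁ M) (complexToRealMat_signMat r s)
    have hre : (signMat ℂ r s).map Complex.re = signMat ℝ r s := by
      simpa [complexToRealMat_apply] using h2
    have him : (signMat ℂ r s).map Complex.im = 0 := by
      have h2 := congrArg (fun M => Matrix.toBlocks₂₁ M) (complexToRealMat_signMat r s)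
      simpa [complexToRealMat_apply] using h2
    have hre' : ∀ i j, (signMat ℂ r s i j).re = signMat ℝ r s i j :=
      fun i j => congrFun (congrFun hre i) j
    have him' : ∀ i j, (signMat ℂ r s i j).im = 0 := fun i j => congrFun (congrFun him i) j
    rintro ((i | i) | (i | i)) ((j | j) | (j | j)) <;>
      simp [complexToRealMat_apply, quaternionRealBasis_apply, hσ, smul_smul, s1, s2, s3,
        t1, t2, t3, t4, t5, t6, t7, t8, t9, h0, h1, hre', him']

theorem quat_re_mul_comm (p q : Quaternion ℝ) : (p * q).re = (q * p).re := by
  simp only [Quaternion.re_mul]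
  ring

/-- Every nonzero purely imaginary quaternion can be moved to `i`. -/
theorem exists_mul_mul_star_eq_quatI {a : Quaternion ℝ} (ha : a.re = 0) (ha0 : a ≠ 0) :
    ∃ e, e * a * star e = quatI := by
  have hN : 0 < Quaternion.normSq a :=
    lt_of_le_of_ne Quaternion.normSq_nonneg (Ne.symm (Quaternion.normSq_ne_zero.mpr ha0))
  have hstar : star a = -a := by
    ext <;> simp [ha]
  have haa : a * a = -((Quaternion.normSq a : ℝ) : Quaternion ℝ) := by
    rw [← Quaternion.self_mul_star, hstar, mul_neg, neg_neg]
  obtain ⟨t1, t2, t3, t4, t5, t6, t7, t8, t9⟩ := quat_mul_table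
  -- With `t = |a|` and `a ^ 2 = -t ^ 2`, the element `e = t i + a` satisfies `e a = t i e`. It
  -- vanishes only for `a = -t i`, where `e = j` works.
  have key : ∃ t : ℝ, 0 < t ∧ ∃ e : Quaternion ℝ, e ≠ 0 ∧ e * a = t • (quatI * e) := by
    set t := √(Quaternion.normSq a) with ht
    have htt : t * t = Quaternion.normSq a := Real.mul_self_sqrt hN.le
    have htpos : 0 < t := Real.sqrt_pos.mpr hN
    refine ⟨t, htpos, ?_⟩
    by_cases h : t • quatI + a = 0
    · refine ⟨quatJ, fun h => ?_, ?_⟩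
      · have := congrArg QuaternionAlgebra.imJ h
        exact one_ne_zero this
      · rw [eq_neg_of_add_eq_zero_right h, mul_neg, mul_smul_comm, t4, t2, smul_neg, neg_neg]
    · refine ⟨_, h, ?_⟩
      rw [add_mul, haa, mul_add, mul_smul_comm, t1, smul_mul_assoc, smul_add, smul_smul, htt,
        add_comm, smul_neg]
      congr 2
      ext <;> simp
  obtain ⟨t, ht, e, he, hea⟩ := key
  have hNe : 0 < Quaternion.normSq e :=
    lt_of_le_of_ne Quaternion.normSq_nonneg (Ne.symm (Quaternion.normSq_ne_zero.mpr he))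
  set r := (√(t * Quaternion.normSq e))⁻¹ with hr
  have hrr : r * r * (t * Quaternion.normSq e) = 1 := by
    rw [hr, ← mul_inv, Real.mul_self_sqrt (by positivity), inv_mul_cancel₀ (by positivity)]
  refine ⟨r • e, ?_⟩
  rw [Quaternion.star_smul, smul_mul_assoc, hea, smul_mul_assoc, smul_mul_assoc, mul_smul_comm,
    mul_assoc, Quaternion.self_mul_star, Quaternion.mul_coe_eq_smul, smul_smul, smul_smul,
    smul_smul]
  rw [show r * t * r * Quaternion.normSq e = 1 by rw [← hrr]; ring, one_smul]

theorem quat_eq_sum (q : Quaternion ℝ) :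
    q = q.re • (1 : Quaternion ℝ) + q.imI • quatI + q.imJ • quatJ + q.imK • quatK := by
  ext <;> simp

theorem imageInConj_OStar (hρ : (matRep κ).IsIrreducible)
    (hκ : ActsAsCommutant (Quaternion ℝ) (matRep κ)) (hb : IsInvForm (matRep κ) b)
    (hσ : ∀ (d : Quaternion ℝ) x y, b (d • x) y = b x (star d • y))
    (hε : ∀ x y, b x y = -b y x) (hnd : ∀ x, (∀ y, b x y = 0) → x = 0) :
    8 ≤ n ∧ ∃ m : ℕ, 4 * m = n ∧ ImageInConj κ ((OStar m).map (quaternionToReal _)) := by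
  obtain ⟨t1, t2, t3, t4, t5, t6, t7, t8, t9⟩ := quat_mul_table
  obtain ⟨s1, s2, s3⟩ := star_quat_units
  -- The functional `-d.imI` is the real part of `i * d`, that is, the real part of the
  -- skew-Hermitian form `i 1`.
  obtain ⟨m, B, hB, horth⟩ := exists_orthogonal_basis_fin (D := Quaternion ℝ) (σ := star)
    (ε := -1) hσ (by simpa using hε) hnd ⟨quatI, by
      rw [s1, smul_neg, neg_one_smul, neg_neg]
      intro h
      have := congrArg QuaternionAlgebra.imI h
      have h' : (1 : ℝ) + 1 = 0 := this
      norm_num at h'⟩ (f := fun d => -d.imI)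
    (fun u hu => by
      by_contra h
      have := hu (quatI * u⁻¹)
      rw [mul_assoc, inv_mul_cancel₀ h, mul_one, quatI_imI] at this
      norm_num at this)
    (fun v ⟨d, hd⟩ => by
      -- Chosen so that `b v (d • v) = Re (a d)`; it is imaginary because `b v v = 0`. Replacing `v`
      -- by `e • v` replaces `a` by `e a ē`, which can be made equal to `i`.
      set a : Quaternion ℝ := ⟨0, -b v (quatI • v), -b v (quatJ • v), -b v (quatK • v)⟩ with ha
      have hvv : b v v = 0 := by linarith [hε v v]
      have hd' : ∀ d : Quaternion ℝ, b v (d • v) = (a * d).re := by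
        intro d
        have h1 : a.re = 0 := rfl
        have h2 : a.imI = -b v (quatI • v) := rfl
        have h3 : a.imJ = -b v (quatJ • v) := rfl
        have h4 : a.imK = -b v (quatK • v) := rfl
        rw [Quaternion.re_mul, h1, h2, h3, h4]
        conv_lhs => rw [quat_eq_sum d]
        simp only [add_smul, map_add, smul_assoc, map_smul, one_smul, hvv, smul_eq_mul]
        ring
      have ha0 : a ≠ 0 := by
        intro h
        rw [hd', h, zero_mul] at hd
        exact hd rfl
      obtain ⟨e, he⟩ := exists_mul_mul_star_eq_quatI (a := a) rfl ha0
      refine ⟨e, fun d => ?_⟩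
      rw [hσ, smul_smul, smul_smul, hd', ← mul_assoc, quat_re_mul_comm, ← mul_assoc, ← mul_assoc,
        he, Quaternion.re_mul]
      simp)
  have hB' : ∀ i j (d : Quaternion ℝ), b (B i) (d • B j) = if i = j then -d.imI else 0 := by
    intro i j d
    split_ifs with h
    · rw [h, hB]
    · exact horth i j h d
  have hm : 4 * m = n := by simpa using card_of_quaternionBasis B
  have := nontrivial_of_isIrreducible hρ
  refine ⟨?_, m, hm, imageInConj_of_basis (quaternionRealBasis B) fun g X hX => ?_⟩
  · by_contra hn
    obtain rfl | rfl : m = 0 ∨ m = 1 := by omega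
    · subst hm
      exact not_subsingleton (Fin 0 → ℝ) inferInstance
    · set v := B 0 with hv
      have hv0 : v ≠ 0 := B.ne_zero 0
      -- In quaternionic dimension one, `g` acts on `v` by a scalar `d` with `imI (d̄ x d) = imI x`
      -- for all `x`. This forces `d` into ℝ + ℝi, so the real plane spanned by `v` and `i v` is
      -- invariant in dimension four.
      have hg : ∀ g, ∃ p q : ℝ, matRep κ g v = p • v + q • quatI • v := by
        intro g
        obtain ⟨d, hd⟩ : ∃ d : Quaternion ℝ, matRep κ g v = d • v :=
          ⟨B.repr (matRep κ g v) 0, by simpa using (B.sum_repr (matRep κ g v)).symm⟩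
        have h1 : ∀ x : Quaternion ℝ, (star d * (x * d)).imI = x.imI := by
          intro x
          have := hb g v (x • v)
          rw [hκ.comm, hd, hσ, smul_smul, smul_smul, hB', hB', if_pos rfl, if_pos rfl,
            neg_inj, mul_assoc] at this
          exact this
        have e1 := h1 quatI
        have e2 := h1 quatJ
        have e3 := h1 quatK
        simp only [Quaternion.imI_mul, Quaternion.imJ_mul, Quaternion.imK_mul, Quaternion.re_mul,
          Quaternion.re_star, Quaternion.imI_star, Quaternion.imJ_star, Quaternion.imK_star,
          quatI_re, quatI_imI, quatI_imJ, quatI_imK, quatJ_re, quatJ_imI, quatJ_imJ, quatJ_imK,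
          quatK_re, quatK_imI, quatK_imJ, quatK_imK] at e1 e2 e3
        -- The two-squares identity: `e2` and `e3` say that `imI imJ + re imK` and `imI imK - re
        -- imJ` vanish, and the product is the sum of their squares. By `e1` its first factor is at
        -- least `1`.
        have e4 : (d.re ^ 2 + d.imI ^ 2) * (d.imJ ^ 2 + d.imK ^ 2) = 0 := by
          linear_combination (d.imI * d.imJ + d.re * d.imK) / 2 * e2 +
            (d.imI * d.imK - d.re * d.imJ) / 2 * e3
        have e5 : d.imJ ^ 2 + d.imK ^ 2 = 0 :=
          (mul_eq_zero.mp e4).resolve_left (by nlinarith [sq_nonneg d.imJ, sq_nonneg d.imK])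
        have e6 : d.imJ = 0 := by nlinarith [sq_nonneg d.imJ, sq_nonneg d.imK]
        have e7 : d.imK = 0 := by nlinarith [sq_nonneg d.imJ, sq_nonneg d.imK]
        refine ⟨d.re, d.imI, ?_⟩
        rw [hd]
        conv_lhs => rw [quat_eq_sum d, e6, e7]
        simp [add_smul]
      rcases eq_bot_or_eq_top_of_invariant hρ (Submodule.span ℝ {v, quatI • v}) (fun g x hx => by
        obtain ⟨x, y, rfl⟩ := Submodule.mem_span_pair.mp hx
        obtain ⟨p, q, hpq⟩ := hg g
        rw [map_add, map_smul, map_smul, hκ.comm, hpq, Submodule.mem_span_pair]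
        refine ⟨x * p - y * q, x * q + y * p, ?_⟩
        rw [smul_add quatI, smul_algebra_smul_comm p quatI v,
          smul_algebra_smul_comm q quatI (quatI • v), smul_smul quatI, t1, neg_one_smul]
        generalize quatI • v = w
        module) with h | h
      · have : v ∈ Submodule.span ℝ {v, quatI • v} := Submodule.subset_span (by simp)
        rw [h] at this
        exact hv0 this
      · have h1 := finrank_span_le_card (R := ℝ) ({v, quatI • v} : Set (Fin n → ℝ))
        rw [h, finrank_top, finrank_fintype_fun_eq_card, Fintype.card_fin] at h1
        have h2 : ({v, quatI • v} : Set (Fin n → ℝ)).toFinset.card ≤ 2 := by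
          rw [Set.toFinset_insert, Set.toFinset_singleton]
          exact Finset.card_le_two
        omega
  · rw [OStar, map_quaternionToReal_eq, quaternionToComplexMat_quatI]
    refine ⟨mem_bilinIsom_of_gram (hb g) hX ?_,
      mem_range_quaternionToReal_of_basis B (hκ.comm g) hX⟩
    have h0 : ∀ i j, b (B i) (B j) = 0 := fun i j => by simpa using hB' i j 1
    rintro ((i | i) | (i | i)) ((j | j) | (j | j)) <;>
      simp [complexToRealMat_apply, quaternionRealBasis_apply, hσ, smul_smul, s1, s2, s3,
        t1, t2, t3, t4, t5, t6, t7, t8, t9, h0, hB', signMat, one_apply, apply_ite]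

end QuaternionicType

/-! ### Schur's lemma and the action of the commutant -/

section Schur

variable {G V : Type*} [Group G] [AddCommGroup V] [Module ℝ V] {ρ : Representation ℝ G V}

/-- A nonzero intertwining map out of an irreducible representation is injective, so a product
vanishes only if a factor does. -/
theorem isDomain_intertwiningMap (hρ : ρ.IsIrreducible) :
    IsDomain (Representation.IntertwiningMap ρ ρ) := by
  have := nontrivial_of_isIrreducible hρ
  have hnt : Nontrivial (Representation.IntertwiningMap ρ ρ) := by
    obtain ⟨x, hx⟩ := exists_ne (0 : V)
    exact ⟨⟨1, 0, fun h => hx (congrArg (fun f : Representation.IntertwiningMap ρ ρ => f x) h)⟩⟩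
  have : NoZeroDivisors (Representation.IntertwiningMap ρ ρ) := ⟨fun {f g} h => by
    rcases Representation.IsIrreducible.injective_or_eq_zero f with hf | hf
    · right
      ext x
      have h1 : f (g x) = 0 := congrArg (fun f : Representation.IntertwiningMap ρ ρ => f x) h
      exact hf (h1.trans (map_zero f).symm)
    · exact Or.inl hf⟩
  let _ : Ring (Representation.IntertwiningMap ρ ρ) := Algebra.semiringToRing ℝ
  exact NoZeroDivisors.to_isDomain (Representation.IntertwiningMap ρ ρ)

theorem finiteDimensional_intertwiningMap [FiniteDimensional ℝ V] :
    FiniteDimensional ℝ (Representation.IntertwiningMap ρ ρ) :=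
  FiniteDimensional.of_injective
    (⟨⟨fun f => f.toLinearMap, fun _ _ => rfl⟩, fun _ _ => rfl⟩ :
      Representation.IntertwiningMap ρ ρ →ₗ[ℝ] (V →ₗ[ℝ] V))
    (Representation.IntertwiningMap.toLinearMap_injective ρ ρ)

/-- For the commutant ℝ the given scalar action is used; no second real module structure on `V` is
introduced. -/
theorem actsAsCommutant_real (φ : Representation.IntertwiningMap ρ ρ ≃ₐ[ℝ] ℝ) :
    ActsAsCommutant ℝ ρ where
  comm g d x := map_smul _ _ _
  exists_smul f hf := by
    let F : Representation.IntertwiningMap ρ ρ := ⟨f, fun g => LinearMap.ext (hf g)⟩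
    refine ⟨φ F, fun x => ?_⟩
    have h : F = algebraMap ℝ _ (φ F) := by
      apply φ.injective
      rw [AlgEquiv.commutes]; rfl
    have h1 : f x = F x := rfl
    rw [h1]
    conv_lhs => rw [h, Algebra.algebraMap_eq_smul_one]
    rfl

theorem exists_actsAsCommutant {D : Type*} [DivisionRing D] [Algebra ℝ D]
    (φ : Representation.IntertwiningMap ρ ρ ≃ₐ[ℝ] D) :
    ∃ (_ : Module D V) (_ : IsScalarTower ℝ D V), ActsAsCommutant D ρ := by
  let F : D →+* Module.End ℝ V :=
    { toFun := fun d => (φ.symm d).toLinearMap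
      map_one' := by rw [map_one]; rfl
      map_mul' := fun d e => by rw [map_mul]; rfl
      map_zero' := by rw [map_zero]; rfl
      map_add' := fun d e => by rw [map_add]; rfl }
  let _ : Module D V := Module.compHom V F
  refine ⟨inferInstance, ⟨fun r d x => ?_⟩, ⟨fun g d x => ?_, fun f hf => ?_⟩⟩
  · change (φ.symm (r • d)).toLinearMap x = r • (φ.symm d).toLinearMap x
    rw [map_smul]; rfl
  · exact ((φ.symm d).isIntertwining _ _ g x).symm
  · let f' : Representation.IntertwiningMap ρ ρ := ⟨f, fun g => LinearMap.ext (hf g)⟩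
    refine ⟨φ f', fun x => ?_⟩
    change f x = (φ.symm (φ f')).toLinearMap x
    rw [AlgEquiv.symm_apply_apply]

end Schur

/-! ### Invariant forms adapted to the commutant -/

section ChoiceOfForm

variable {G V : Type*} [Group G] [AddCommGroup V] [Module ℝ V] {ρ : Representation ℝ G V}

/-- One of `b ± b.flip` is nonzero. The last clause holds because a map scaling `b` by `s` scales
`b.flip` by `s` too; it lets symmetrization follow an averaging over units. -/
theorem exists_symmetrized {b : LinearMap.BilinForm ℝ V} (hb : IsInvForm ρ b) (hb0 : b ≠ 0) :
    ∃ b' : LinearMap.BilinForm ℝ V, IsInvForm ρ b' ∧ b' ≠ 0 ∧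
      (∃ c : ℝ, (c = 1 ∨ c = -1) ∧ ∀ x y, b' x y = c * b' y x) ∧
      ∀ (f : V → V) (s : ℝ), (∀ x y, b (f x) (f y) = s * b x y) →
        ∀ x y, b' (f x) (f y) = s * b' x y := by
  obtain ⟨c, hc, h0, hsymm⟩ := exists_isSymm_or_isSkew hb0
  refine ⟨_, hb.add_smul_flip c, h0, ⟨c, hc, hsymm⟩, fun f s h x y => ?_⟩
  change b _ _ + c * b _ _ = s * (b x y + c * b y x)
  rw [h, h]
  ring

variable {D : Type*} [DivisionRing D] [Module D V]

/-- Substituting `u • y` for `y`: a unit acting as an isometry has adjoint `-u`, one that reverses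
the sign of the form has adjoint `u`. -/
theorem apply_smul_left_of_isometry {b : LinearMap.BilinForm ℝ V} {u : D} (hu : u * u = -1) {s : ℝ}
    (h : ∀ x y, b (u • x) (u • y) = s * b x y) (x y : V) : b (u • x) y = -s * b x (u • y) := by
  have := h x (u • y)
  rw [smul_smul, hu, neg_one_smul, map_neg] at this
  linarith

variable [Algebra ℝ D] [IsScalarTower ℝ D V]

/-- Pullback of a form along multiplication by a scalar. -/
def pullForm (b : LinearMap.BilinForm ℝ V) (u : D) : LinearMap.BilinForm ℝ V :=
  LinearMap.BilinForm.comp b (smulMap V u) (smulMap V u)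

@[simp]
theorem pullForm_apply (b : LinearMap.BilinForm ℝ V) (u : D) (x y : V) :
    pullForm b u x y = b (u • x) (u • y) := rfl

theorem ActsAsCommutant.isInvForm_pullForm (h : ActsAsCommutant D ρ)
    {b : LinearMap.BilinForm ℝ V} (hb : IsInvForm ρ b) (u : D) : IsInvForm ρ (pullForm b u) :=
  fun g x y => by rw [pullForm_apply, pullForm_apply, ← h.comm, ← h.comm, hb]

theorem IsInvForm.add {b b' : LinearMap.BilinForm ℝ V} (hb : IsInvForm ρ b)
    (hb' : IsInvForm ρ b') : IsInvForm ρ (b + b') := fun g x y => by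
  rw [LinearMap.add_apply, LinearMap.add_apply, LinearMap.add_apply, LinearMap.add_apply, hb, hb']

/-- Pullback along `i` is an involution on forms. If `b` plus its pullback is nonzero, `i` is an
isometry of it and the adjoint is conjugation; otherwise `i` reverses the sign of `b` and the
adjoint is the identity. -/
theorem exists_complex_form [Module ℂ V] [IsScalarTower ℝ ℂ V] (h : ActsAsCommutant ℂ ρ)
    {b : LinearMap.BilinForm ℝ V} (hb : IsInvForm ρ b) (hb0 : b ≠ 0) :
    (∃ b' : LinearMap.BilinForm ℝ V, IsInvForm ρ b' ∧ b' ≠ 0 ∧ (∀ x y, b' x y = b' y x) ∧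
      ∀ (d : ℂ) x y, b' (d • x) y = b' x (star d • y)) ∨
    ∃ b' : LinearMap.BilinForm ℝ V, IsInvForm ρ b' ∧ b' ≠ 0 ∧
      (∃ c : ℝ, (c = 1 ∨ c = -1) ∧ ∀ x y, b' x y = c * b' y x) ∧
      ∀ (d : ℂ) x y, b' (d • x) y = b' x (d • y) := by
  have hd : ∀ (d : ℂ) (x : V), d • x = d.re • x + d.im • Complex.I • x := by
    intro d x
    have hc : ∀ (r : ℝ) (x : V), (r : ℂ) • x = r • x := fun r x => algebraMap_smul ℂ r x
    rw [← hc, ← hc, smul_smul, ← add_smul, Complex.re_add_im]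
  by_cases h0 : b + pullForm b Complex.I = 0
  · right
    obtain ⟨b', hb', hb'0, hc, hf⟩ := exists_symmetrized hb hb0
    refine ⟨b', hb', hb'0, hc, fun d x y => ?_⟩
    have h1 := hf (fun x => Complex.I • x) (-1) fun x y => by
      have := LinearMap.congr_fun (LinearMap.congr_fun h0 x) y
      simp only [LinearMap.add_apply, pullForm_apply, LinearMap.zero_apply] at this
      linarith
    have h2 := apply_smul_left_of_isometry Complex.I_mul_I h1
    rw [hd d x, hd d y]
    simp [h2]
  · left
    obtain ⟨b', hb', hb'0, ⟨c, hc, hsymm⟩, hf⟩ :=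
      exists_symmetrized (hb.add (h.isInvForm_pullForm hb Complex.I)) h0
    have h1 := hf (fun x => Complex.I • x) 1 fun x y => by
      simp [smul_smul, add_comm]
    have h2 := apply_smul_left_of_isometry Complex.I_mul_I h1
    have h3 : ∀ (d : ℂ) x y, b' (d • x) y = b' x (star d • y) := by
      intro d x y
      rw [hd d x, hd (star d) y]
      simp [h2]
    rcases hc with rfl | rfl
    · exact ⟨b', hb', hb'0, by simpa using hsymm, h3⟩
    -- A skew-Hermitian form becomes Hermitian after multiplication by `i`.
    · refine ⟨twistForm ℂ b' Complex.I, h.isInvForm_twistForm hb' _, fun h4 => hb'0 ?_,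
        fun x y => ?_, fun d x y => ?_⟩
      · ext x y
        have := LinearMap.congr_fun (LinearMap.congr_fun h4 (-Complex.I • x)) y
        simpa [smul_smul] using this
      · rw [twistForm_apply, twistForm_apply, h2, hsymm x]
        ring
      · rw [twistForm_apply, twistForm_apply, smul_comm, h3]

/-- Averaging over `1, i, j, k` makes the units isometries, so the adjoint is conjugation. The
average of `b` may be zero, but that of some twist of `b` is not. -/
theorem exists_quaternion_form [Module (Quaternion ℝ) V] [IsScalarTower ℝ (Quaternion ℝ) V]
    (h : ActsAsCommutant (Quaternion ℝ) ρ)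
    {b : LinearMap.BilinForm ℝ V} (hb : IsInvForm ρ b) (hb0 : b ≠ 0) :
    ∃ b' : LinearMap.BilinForm ℝ V, IsInvForm ρ b' ∧ b' ≠ 0 ∧
      (∃ c : ℝ, (c = 1 ∨ c = -1) ∧ ∀ x y, b' x y = c * b' y x) ∧
      ∀ (d : Quaternion ℝ) x y, b' (d • x) y = b' x (star d • y) := by
  obtain ⟨t1, t2, t3, t4, t5, t6, t7, t8, t9⟩ := quat_mul_table
  obtain ⟨s1, s2, s3⟩ := star_quat_units
  let M : LinearMap.BilinForm ℝ V → LinearMap.BilinForm ℝ V := fun b =>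
    b + pullForm b quatI + pullForm b quatJ + pullForm b quatK
  have hMinv : ∀ b, IsInvForm ρ b → IsInvForm ρ (M b) := fun b hb =>
    ((hb.add (h.isInvForm_pullForm hb _)).add (h.isInvForm_pullForm hb _)).add
      (h.isInvForm_pullForm hb _)
  have hM : ∃ d : Quaternion ℝ, M (twistForm (Quaternion ℝ) b d) ≠ 0 := by
    by_contra! h0
    have h1 : ∀ (d : Quaternion ℝ) x y, M (twistForm (Quaternion ℝ) b d) x y = 0 := fun d x y => by
      rw [h0]; rfl
    refine hb0 (LinearMap.ext fun x => LinearMap.ext fun y => ?_)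
    -- The combination `e1 - e2 - e3 - e4` has left side `4 * b x y`: the other pullback terms
    -- cancel.
    have e1 := h1 1 x y
    have e2 := h1 quatI (quatI • x) y
    have e3 := h1 quatJ (quatJ • x) y
    have e4 := h1 quatK (quatK • x) y
    simp only [M, LinearMap.add_apply, pullForm_apply, twistForm_apply, smul_smul, one_mul,
      one_smul, t1, t2, t3, t4, t5, t6, t7, t8, t9, neg_neg, neg_smul, map_neg,
      LinearMap.neg_apply] at e1 e2 e3 e4
    rw [LinearMap.zero_apply, LinearMap.zero_apply]
    linarith
  obtain ⟨d₀, hd₀⟩ := hM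
  obtain ⟨b', hb', hb'0, hc, hf⟩ := exists_symmetrized (hMinv _ (h.isInvForm_twistForm hb d₀)) hd₀
  refine ⟨b', hb', hb'0, hc, ?_⟩
  have hMI : ∀ (b : LinearMap.BilinForm ℝ V) x y, M b (quatI • x) (quatI • y) = 1 * M b x y := by
    intro b x y
    simp only [M, LinearMap.add_apply, pullForm_apply, smul_smul, t1, t4, t7, neg_smul, one_smul,
      map_neg, LinearMap.neg_apply]
    ring
  have hMJ : ∀ (b : LinearMap.BilinForm ℝ V) x y, M b (quatJ • x) (quatJ • y) = 1 * M b x y := by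
    intro b x y
    simp only [M, LinearMap.add_apply, pullForm_apply, smul_smul, t2, t5, t8, neg_smul, one_smul,
      map_neg, LinearMap.neg_apply]
    ring
  have hMK : ∀ (b : LinearMap.BilinForm ℝ V) x y, M b (quatK • x) (quatK • y) = 1 * M b x y := by
    intro b x y
    simp only [M, LinearMap.add_apply, pullForm_apply, smul_smul, t3, t6, t9, neg_smul, one_smul,
      map_neg, LinearMap.neg_apply]
    ring
  have hI := apply_smul_left_of_isometry t1 (hf (fun x => quatI • x) 1 (hMI _))
  have hJ := apply_smul_left_of_isometry t5 (hf (fun x => quatJ • x) 1 (hMJ _))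
  have hK := apply_smul_left_of_isometry t9 (hf (fun x => quatK • x) 1 (hMK _))
  intro d x y
  have hs : star d = d.re • (1 : Quaternion ℝ) + d.imI • -quatI + d.imJ • -quatJ +
      d.imK • -quatK := by
    ext <;> simp
  rw [hs]
  conv_lhs => rw [quat_eq_sum d]
  simp [add_smul, hI, hJ, hK]

end ChoiceOfForm

/-! ### Classification by type of commutant -/

section Main

variable {G : Type*} [Group G] {n : ℕ} {κ : G →* GL (Fin n) ℝ}

theorem classification_real (hρ : (matRep κ).IsIrreducible) (hd : IsSelfDual (matRep κ))
    (φ : Representation.IntertwiningMap (matRep κ) (matRep κ) ≃ₐ[ℝ] ℝ) :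
    (HasType (matRep κ) ℝ 1 0 ∧ ∃ p q : ℕ, p + q = n ∧ ImageInConj κ (O p q)) ∨
    (HasType (matRep κ) ℝ 0 1 ∧ ∃ m : ℕ, 2 * m = n ∧ ImageInConj κ (SpR m)) := by
  have := nontrivial_of_isIrreducible hρ
  have h := actsAsCommutant_real φ
  obtain ⟨b₀, hb₀, hb₀0⟩ := exists_invForm_ne_zero hρ hd
  obtain ⟨b, hb, hb0, ⟨c, hc, hε⟩, -⟩ := exists_symmetrized hb₀ hb₀0
  have hnd := eq_zero_of_forall_apply_eq_zero hρ hb hb0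
  rcases hc with rfl | rfl
  · left
    obtain ⟨h1, h2⟩ := h.finrank_forms_of_id hb hnd (by simp) hε (fun _ => mem_symForms)
      (fun _ => mem_skewForms) (by norm_num)
    exact ⟨⟨⟨φ⟩, by rw [h1, finrank_self], h2⟩, imageInConj_O hb (by simpa using hε) hnd⟩
  · right
    obtain ⟨h1, h2⟩ := h.finrank_forms_of_id hb hnd (by simp) hε (fun _ => mem_skewForms)
      (fun _ => by rw [neg_neg]; exact mem_symForms) (by norm_num)
    exact ⟨⟨⟨φ⟩, h2, by rw [h1, finrank_self]⟩, imageInConj_SpR hb (by simpa using hε) hnd⟩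

theorem classification_complex (hρ : (matRep κ).IsIrreducible) (hd : IsSelfDual (matRep κ))
    (φ : Representation.IntertwiningMap (matRep κ) (matRep κ) ≃ₐ[ℝ] ℂ) :
    (HasType (matRep κ) ℂ 2 0 ∧ 4 ≤ n ∧ ∃ m : ℕ, 2 * m = n ∧
      ImageInConj κ ((OC m).map (complexToReal _))) ∨
    (HasType (matRep κ) ℂ 0 2 ∧ ∃ m : ℕ, 4 * m = n ∧
      ImageInConj κ ((SpC m).map (complexToReal _))) ∨
    (HasType (matRep κ) ℂ 1 1 ∧ ∃ r s : ℕ, 2 * r + 2 * s = n ∧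
      ImageInConj κ ((U r s).map (complexToReal _))) := by
  have := nontrivial_of_isIrreducible hρ
  obtain ⟨_, _, h⟩ := exists_actsAsCommutant φ
  obtain ⟨b₀, hb₀, hb₀0⟩ := exists_invForm_ne_zero hρ hd
  rcases exists_complex_form h hb₀ hb₀0 with ⟨b, hb, hb0, hε, hσ⟩ | ⟨b, hb, hb0, ⟨c, hc, hε⟩, hσ⟩
  · right; right
    have hnd := eq_zero_of_forall_apply_eq_zero hρ hb hb0
    obtain ⟨h1, h2⟩ := h.finrank_forms_of_conj hb hnd hσ (ε := 1) (by simpa using hε)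
      (re := Complex.reLm) (fun d => by apply Complex.ext <;> simp; ring) (by simp)
      (fun _ => mem_symForms) (fun _ => mem_skewForms) (by norm_num)
    rw [Complex.finrank_real_complex] at h2
    exact ⟨⟨⟨φ⟩, h1, by omega⟩, imageInConj_U h hb hσ hε hnd⟩
  · have hnd := eq_zero_of_forall_apply_eq_zero hρ hb hb0
    rcases hc with rfl | rfl
    · left
      obtain ⟨h1, h2⟩ := h.finrank_forms_of_id hb hnd hσ hε (fun _ => mem_symForms)
        (fun _ => mem_skewForms) (by norm_num)
      exact ⟨⟨⟨φ⟩, by rw [h1, Complex.finrank_real_complex], h2⟩,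
        imageInConj_OC hρ h hb hσ (by simpa using hε) hnd⟩
    · right; left
      obtain ⟨h1, h2⟩ := h.finrank_forms_of_id hb hnd hσ hε (fun _ => mem_skewForms)
        (fun _ => by rw [neg_neg]; exact mem_symForms) (by norm_num)
      exact ⟨⟨⟨φ⟩, h2, by rw [h1, Complex.finrank_real_complex]⟩,
        imageInConj_SpC h hb hσ (by simpa using hε) hnd⟩

/-- Over ℍ, twisting by an imaginary unit would alter the adjoint involution, so unlike over ℂ the
skew-Hermitian case is not reduced to the Hermitian one and stands as a separate type. -/
theorem classification_quaternion (hρ : (matRep κ).IsIrreducible) (hd : IsSelfDual (matRep κ))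
    (φ : Representation.IntertwiningMap (matRep κ) (matRep κ) ≃ₐ[ℝ] Quaternion ℝ) :
    (HasType (matRep κ) (Quaternion ℝ) 1 3 ∧ ∃ r s : ℕ, 4 * r + 4 * s = n ∧
      ImageInConj κ ((SpH r s).map (quaternionToReal _))) ∨
    (HasType (matRep κ) (Quaternion ℝ) 3 1 ∧ 8 ≤ n ∧ ∃ m : ℕ, 4 * m = n ∧
      ImageInConj κ ((OStar m).map (quaternionToReal _))) := by
  have := nontrivial_of_isIrreducible hρ
  obtain ⟨_, _, h⟩ := exists_actsAsCommutant φ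
  obtain ⟨b₀, hb₀, hb₀0⟩ := exists_invForm_ne_zero hρ hd
  obtain ⟨b, hb, hb0, ⟨c, hc, hε⟩, hσ⟩ := exists_quaternion_form h hb₀ hb₀0
  have hnd := eq_zero_of_forall_apply_eq_zero hρ hb hb0
  have h4 : finrank ℝ (Quaternion ℝ) = 4 := Quaternion.finrank_eq_four
  rcases hc with rfl | rfl
  · left
    obtain ⟨h1, h2⟩ := h.finrank_forms_of_conj hb hnd hσ hε (re := quatRe) quat_add_star
      (by simp) (fun _ => mem_symForms) (fun _ => mem_skewForms) (by norm_num)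
    exact ⟨⟨⟨φ⟩, h1, by omega⟩, imageInConj_SpH h hb hσ (by simpa using hε) hnd⟩
  · right
    obtain ⟨h1, h2⟩ := h.finrank_forms_of_conj hb hnd hσ hε (re := quatRe) quat_add_star
      (by simp) (fun _ => mem_skewForms) (fun _ => by rw [neg_neg]; exact mem_symForms)
      (by norm_num)
    exact ⟨⟨⟨φ⟩, by omega, h1⟩, imageInConj_OStar hρ h hb hσ (by simpa using hε) hnd⟩

end Main

end ClassicalGroups

/-! ### The theorem -/

open ClassicalGroups in
theorem proposition5 :
    -- Part 1: types of irreducible self-dual representations and maximal groups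
    (∀ (G : Type*) [Group G] (n : ℕ) (κ : G →* GL (Fin n) ℝ),
      (matRep κ).IsIrreducible → IsSelfDual (matRep κ) →
        (HasType (matRep κ) ℝ 1 0 ∧ ∃ p q : ℕ, p + q = n ∧ ImageInConj κ (O p q)) ∨
        (HasType (matRep κ) ℝ 0 1 ∧ ∃ m : ℕ, 2 * m = n ∧ ImageInConj κ (SpR m)) ∨
        (HasType (matRep κ) ℂ 2 0 ∧ 4 ≤ n ∧ ∃ m : ℕ, 2 * m = n ∧
          ImageInConj κ ((OC m).map (complexToReal _))) ∨
        (HasType (matRep κ) ℂ 0 2 ∧ ∃ m : ℕ, 4 * m = n ∧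
          ImageInConj κ ((SpC m).map (complexToReal _))) ∨
        (HasType (matRep κ) ℂ 1 1 ∧ ∃ r s : ℕ, 2 * r + 2 * s = n ∧
          ImageInConj κ ((U r s).map (complexToReal _))) ∨
        (HasType (matRep κ) (Quaternion ℝ) 1 3 ∧ ∃ r s : ℕ, 4 * r + 4 * s = n ∧
          ImageInConj κ ((SpH r s).map (quaternionToReal _))) ∨
        (HasType (matRep κ) (Quaternion ℝ) 3 1 ∧ 8 ≤ n ∧ ∃ m : ℕ, 4 * m = n ∧
          ImageInConj κ ((OStar m).map (quaternionToReal _)))) ∧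
    -- Part 2: the embeddings are injective, so that each group is isomorphic to its image
    (∀ (ι : Type) [Fintype ι] [DecidableEq ι],
      Function.Injective (complexToReal ι) ∧ Function.Injective (quaternionToComplex ι)) ∧
    -- `O(m, ℂ) = O(m, m) ∩ GL(m, ℂ)`
    (∀ m : ℕ, (OC m).map (complexToReal _) = O m m ⊓ (complexToReal (Fin m)).range) ∧
    -- `Sp(m, ℂ) = Sp(2m, ℝ) ∩ GL(2m, ℂ)`
    (∀ m : ℕ,
      IsConjTo (bilinIsom (Matrix.fromBlocks (sympMat ℝ m) 0 0 (-sympMat ℝ m)))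
        (SpR (2 * m)) ∧
      (SpC m).map (complexToReal _) =
        bilinIsom (Matrix.fromBlocks (sympMat ℝ m) 0 0 (-sympMat ℝ m)) ⊓
          (complexToReal (Fin m ⊕ Fin m)).range) ∧
    -- `U(r, s) = O(2r, 2s) ∩ Sp(r + s, ℝ)`
    (∀ r s : ℕ,
      IsConjTo (bilinIsom (Matrix.fromBlocks (signMat ℝ r s) 0 0 (signMat ℝ r s)))
        (O (2 * r) (2 * s)) ∧
      IsConjTo (bilinIsom (Matrix.fromBlocks 0 (signMat ℝ r s) (-signMat ℝ r s) 0))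
        (SpR (r + s)) ∧
      (U r s).map (complexToReal _) =
        bilinIsom (Matrix.fromBlocks (signMat ℝ r s) 0 0 (signMat ℝ r s)) ⊓
          bilinIsom (Matrix.fromBlocks 0 (signMat ℝ r s) (-signMat ℝ r s) 0)) ∧
    -- `Sp(r, s) = U(2r, 2s) ∩ Sp(r + s, ℂ)`
    (∀ r s : ℕ,
      IsConjTo (sesqIsom (Matrix.fromBlocks (signMat ℂ r s) 0 0 (signMat ℂ r s)))
        (U (2 * r) (2 * s)) ∧
      IsConjTo (bilinIsom (Matrix.fromBlocks 0 (-signMat ℂ r s) (signMat ℂ r s) 0))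
        (SpC (r + s)) ∧
      (SpH r s).map (quaternionToComplex _) =
        sesqIsom (Matrix.fromBlocks (signMat ℂ r s) 0 0 (signMat ℂ r s)) ⊓
          bilinIsom (Matrix.fromBlocks 0 (-signMat ℂ r s) (signMat ℂ r s) 0)) ∧
    -- `O*(m) = U(m, m) ∩ O(2m, ℂ)`
    (∀ m : ℕ,
      IsConjTo (bilinIsom (Matrix.fromBlocks 0 1 1 0 : Matrix (Fin m ⊕ Fin m) (Fin m ⊕ Fin m) ℂ))
        (OC (2 * m)) ∧
      (OStar m).map (quaternionToComplex _) =
        U m m ⊓ bilinIsom (Matrix.fromBlocks 0 1 1 0 : Matrix (Fin m ⊕ Fin m) (Fin m ⊕ Fin m) ℂ)) := by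
  refine ⟨fun G _ n κ hρ hd => ?_, fun ι _ _ => ⟨complexToReal_injective,
    quaternionToComplex_injective⟩, map_complexToReal_OC,
    fun m => ⟨isConjTo_sympMat_two_mul m, map_complexToReal_SpC m⟩,
    fun r s => ⟨isConjTo_O_two_mul r s, ?_, map_complexToReal_U r s⟩,
    fun r s => ⟨isConjTo_U_two_mul r s, isConjTo_sympMat_add ℂ r s,
      map_quaternionToComplex_SpH r s⟩,
    fun m => ⟨isConjTo_OC_two_mul m, map_quaternionToComplex_OStar m⟩⟩
  -- Frobenius' theorem needs subtraction; this ring structure extends the semiring of intertwining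
  -- maps.
  · let _ : Ring (Representation.IntertwiningMap (matRep κ) (matRep κ)) :=
      Algebra.semiringToRing ℝ
    have : IsDomain (Representation.IntertwiningMap (matRep κ) (matRep κ)) :=
      isDomain_intertwiningMap hρ
    have := finiteDimensional_intertwiningMap (ρ := matRep κ)
    rcases frobenius_real (E := Representation.IntertwiningMap (matRep κ) (matRep κ)) with
      ⟨⟨φ⟩⟩ | ⟨⟨φ⟩⟩ | ⟨⟨φ⟩⟩
    · rcases classification_real hρ hd φ with h | h
      · exact Or.inl h
      · exact Or.inr (Or.inl h)
    · rcases classification_complex hρ hd φ with h | h | h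
      · exact Or.inr (Or.inr (Or.inl h))
      · exact Or.inr (Or.inr (Or.inr (Or.inl h)))
      · exact Or.inr (Or.inr (Or.inr (Or.inr (Or.inl h))))
    · rcases classification_quaternion hρ hd φ with h | h
      · exact Or.inr (Or.inr (Or.inr (Or.inr (Or.inr (Or.inl h)))))
      · exact Or.inr (Or.inr (Or.inr (Or.inr (Or.inr (Or.inr h)))))
  -- The form here is the negative of the one in `isConjTo_sympMat_add`, with the same isometry
  -- group.
  · have h := isConjTo_sympMat_add ℝ r s
    rw [← bilinIsom_neg] at h
    simpa [fromBlocks_neg, SpR] using h
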